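/- Notation. Let $H=\ell_2(\mathbb N)$ (complex scalars), and let $B(H)$ be the algebra of bounded operators on $H$, with the usual order of self-adjoint operators and the norm topology. For $T,S\in B(H)$ write $T\gg S$ if $TS=S$. For a finite-rank operator $h$ let $h^+$ be the orthogonal projection onto $h[H]$ and $h^-$ the orthogonal projection onto $\{\xi: h\xi=\xi\}$. Let $B_f(H)^{\le1}_+$ be the set of finite-rank positive contractions on $H$. Parameters. Fix an increasing sequence $\mathcal P$ of finite-rank orthogonal projections converging strongly to the identity and a countable dense subset $C$ of $B_f(H)^{\le 1}_+$. For $R\in\mathcal P$, $h\in C$ let $S_{R,h}$ be the orthogonal projection onto $\operatorname{span}(h^+[H]\cup R[H])$ and let $D_{R,h}$ be a countable dense subset of $S_{R,h}B(H)h^+$ with $h^+\in D_{R,h}$. Assume that: (i) for all $k\ge 1$, $c_1,\dots,c_k\in C$ and $R\in\mathcal P$, the intersection of $C$ with $\{h\in B_f(H)^{\le1}_+: h\gg c_1,\dots,h\gg c_k,\ h\ge R\}$ is dense in the latter; (ii) for all $R\in\mathcal P$ and $h,k\in C$, the intersection of $D_{R,h}$ with $\{T\in S_{R,h}B(H)h^+: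 Tk^-[H]\subseteq h^-[H],\ Th^-[H]\subseteq h^+[H]\}$ is dense in the latter; (iii) for all $R,R'\in\mathcal P$, $h_1,h_2,k\in C$ and $T'\in D_{R',h_2}$, the intersection of $D_{R,h_1}$ with $\{T\in S_{R,h_1}B(H)h_1^+: Th_2^+=T',\ h_2^-T=h_2^-T',\ Tk^-[H]\subseteq h_1^-[H],\ Th_1^-[H]\subseteq h_1^+[H]\}$ is dense in the latter. The poset. Let $A$ be a simple unital $C^*$-algebra. For a finite $F\subset A$ let $L(F)$ be the maximum of $|\lambda|$ over all $\lambda\in\mathbb C$ for which there are $\mu\in\mathbb C$ and $a,b\in F$ with $\lambda a+\mu b\in F$ and such that either $a,b$ are linearly independent, or $a\ne0$ and $\mu=0$. Let $\mathbb E_A$ be the set of tuples $p=(F_p,\epsilon_p,h_p,R_p,\psi_p)$ where $F_p\subset A$ is finite, $1\in F_p$, $F_p^*=F_p$, $\epsilon_p\in\mathbb Q^+$, $h_p\in C$, $R_p\in\mathcal P$, and $\psi_p:F_p\to D_{R_p,h_p}$ is a map for which there exist a unital $*$-homomorphism $\Phi_p:C^*(F_p)\to B(H)$ that is faithful and essential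 (the only compact operator in its range is $0$) and a projection $k_p\le h_p^-$ such that, with $M_p=\max\{3\|a\|,3\|\psi_p(a)\|,L(F_p):a\in F_p\}$, for all $a\in F_p$: (a) $k_p=k^-$ for some $k\in C$; (b) $\psi_p(1)=h_p^+$; (c) $\|(\psi_p(a)-\Phi_p(a))(h_p^+-k_p)\|<\epsilon_p/(3M_p)$; (d) $\|\psi_p(a)+\Phi_p(a)(1-h_p^+)\|<\frac32\|a\|$; (e) $\psi_p(a)k_p[H]\subseteq h_p^-[H]$ and $\psi_p(a)h_p^-[H]\subseteq h_p^+[H]$; (f) $\Phi_p(a)k_p[H]\subseteq h_p^-[H]$ and $\Phi_p(a)h_p^-[H]\subseteq h_p^+[H]$. For $p,q\in\mathbb E_A$ put $p<q$ if $F_p\supseteq F_q$, $\epsilon_p<\epsilon_q$, $h_p\gg h_q$, $R_p\ge R_q$, for all $a\in F_q$ both $\psi_p(a)h_q^+=\psi_q(a)$ and $h_q^-\psi_p(a)=h_q^-\psi_q(a)$, and, with $E=h_p^--h_q^-$, $\|(\psi_p(\lambda a+\mu b)-\lambda\psi_p(a)-\mu\psi_p(b))E\|<\epsilon_q-\epsilon_p$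 whenever $a,b,\lambda a+\mu b\in F_q$ and $|\lambda|,|\mu|\le L(F_q)$; $\|(\psi_p(a^*)-\psi_p(a)^*)E\|<\epsilon_q-\epsilon_p$ whenever $a\in F_q$; $\|(\psi_p(ab)-\psi_p(a)\psi_p(b))E\|<\epsilon_q-\epsilon_p$ whenever $a,b,ab\in F_q$. Write $p\le q$ if $p<q$ or $p=q$. Proposition. For every finite $F\subset A$ with $0\notin F$, every $\epsilon\in\mathbb Q^+$, $h\in C$ and $R\in\mathcal P$, the set $$\mathcal D_{F,\epsilon,h,R}=\{p\in\mathbb E_A: F_p\supseteq F,\ \epsilon_p\le\epsilon,\ h_p\gg h,\ R_p\ge R\}$$ is open dense in $\mathbb E_A$: it is closed downwards, and for every $q\in\mathbb E_A$ there is $p\in\mathcal D_{F,\epsilon,h,R}$ with $p\le q$. -/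

import Mathlib

namespace CalkinForcing

noncomputable section

/-- The Hilbert space `ℓ₂(ℕ)` over the complex numbers. -/
abbrev Hilb : Type := lp (fun _ : ℕ => ℂ) 2

/-- The algebra of bounded operators on `ℓ₂(ℕ)`. -/
abbrev Op : Type := Hilb →L[ℂ] Hilb

/-- `T` is way above `S`, written `T ≫ S` in the literature: `T S = S`. -/
def WayAbove (T S : Op) : Prop := T * S = S

/-- Finite-rank operators. -/
def FiniteRank (T : Op) : Prop := FiniteDimensional ℂ (LinearMap.range T.toLinearMap)

/-- The finite-rank positive contractions. (On operators, `≤` is the Loewner order.) -/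
def posContr : Set Op := {h | FiniteRank h ∧ 0 ≤ h ∧ ‖h‖ ≤ 1}

/-- `h⁺`: the orthogonal projection onto the range of `h` (for a general operator, onto the closure
of the range; for finite-rank `h` the range is closed). -/
def high (h : Op) : Op := (LinearMap.range h.toLinearMap).topologicalClosure.starProjection

/-- `h⁻`: the orthogonal projection onto the space of all `ξ` with `h ξ = ξ`. -/
def low (h : Op) : Op := (LinearMap.ker (h - 1).toLinearMap).starProjection

/-- `S_{R,h}`: the orthogonal projection onto the span of `h⁺[H] ∪ R[H]` (which is finite-dimensional,
hence closed, when `h` and `R` have finite rank). -/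
def joinProj (R h : Op) : Op :=
  (Submodule.span ℂ (Set.range (high h) ∪ Set.range R)).topologicalClosure.starProjection

/-- `T[P[H]] ⊆ Q[H]`. -/
def MapsRange (T P Q : Op) : Prop := Set.MapsTo T (Set.range P) (Set.range Q)

/-- `S_{R,h} B(H) h⁺`. -/
def corner (R h : Op) : Set Op := {T | ∃ X : Op, T = joinProj R h * X * high h}

/-- The fixed parameters of the forcing notion: an increasing sequence `proj` of finite-rank
projections converging strongly to the identity, a countable dense set `C` of finite-rank positive
contractions and countable dense sets `D R h` of the corners, with the closure properties
required of them. `D R h` is only relevant for `R` in the range of `proj` and `h ∈ C`. -/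
structure Params where
  proj : ℕ → Op
  proj_isStarProjection : ∀ n, IsStarProjection (proj n)
  proj_finiteRank : ∀ n, FiniteRank (proj n)
  proj_mono : Monotone proj
  proj_tendsto : ∀ ξ : Hilb, Filter.Tendsto (fun n => proj n ξ) Filter.atTop (nhds ξ)
  C : Set Op
  C_countable : C.Countable
  C_subset : C ⊆ posContr
  C_dense : posContr ⊆ closure C
  D : Op → Op → Set Op
  D_countable : ∀ R ∈ Set.range proj, ∀ h ∈ C, (D R h).Countable
  D_subset : ∀ R ∈ Set.range proj, ∀ h ∈ C, D R h ⊆ corner R h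
  D_dense : ∀ R ∈ Set.range proj, ∀ h ∈ C, corner R h ⊆ closure (D R h)
  high_mem_D : ∀ R ∈ Set.range proj, ∀ h ∈ C, high h ∈ D R h
  closure_C : ∀ s : Finset Op, s.Nonempty → (s : Set Op) ⊆ C → ∀ R ∈ Set.range proj,
    {h | h ∈ posContr ∧ (∀ c ∈ s, WayAbove h c) ∧ R ≤ h} ⊆
      closure (C ∩ {h | h ∈ posContr ∧ (∀ c ∈ s, WayAbove h c) ∧ R ≤ h})
  closure_D : ∀ R ∈ Set.range proj, ∀ h ∈ C, ∀ k ∈ C,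
    {T | T ∈ corner R h ∧ MapsRange T (low k) (low h) ∧ MapsRange T (low h) (high h)} ⊆
      closure (D R h ∩
        {T | T ∈ corner R h ∧ MapsRange T (low k) (low h) ∧ MapsRange T (low h) (high h)})
  closure_D_extend : ∀ R ∈ Set.range proj, ∀ R' ∈ Set.range proj,
    ∀ h₁ ∈ C, ∀ h₂ ∈ C, ∀ k ∈ C, ∀ T' ∈ D R' h₂,
    {T | T ∈ corner R h₁ ∧ T * high h₂ = T' ∧ low h₂ * T = low h₂ * T' ∧
        MapsRange T (low k) (low h₁) ∧ MapsRange T (low h₁) (high h₁)} ⊆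
      closure (D R h₁ ∩
        {T | T ∈ corner R h₁ ∧ T * high h₂ = T' ∧ low h₂ * T = low h₂ * T' ∧
          MapsRange T (low k) (low h₁) ∧ MapsRange T (low h₁) (high h₁)})

variable {A : Type*} [CStarAlgebra A]

/-- A (unital) C⋆-algebra is simple if it is non-zero and has no closed two-sided ideals other than
`0` and itself. -/
def IsSimpleCStar (A : Type*) [CStarAlgebra A] : Prop :=
  Nontrivial A ∧ ∀ I : TwoSidedIdeal A, IsClosed (I : Set A) → I = ⊥ ∨ I = ⊤

/-- The C⋆-algebra `C⋆(F)` generated by `F` (and the unit, which lies in `F` whenever this is used). -/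
def genCStar (F : Finset A) : StarSubalgebra ℂ A :=
  (StarAlgebra.adjoin ℂ (F : Set A)).topologicalClosure

theorem mem_genCStar {F : Finset A} {a : A} (ha : a ∈ F) : a ∈ genCStar F :=
  StarSubalgebra.le_topologicalClosure _ (StarAlgebra.subset_adjoin ℂ _ ha)

/-- The coefficients `lam` of the non-degenerate linear combinations `lam a + mu b` of elements
of `F` that lie in `F`: either `a, b` are linearly independent, or `a ≠ 0` and `mu = 0`. -/
def coeffs (F : Finset A) : Set ℂ :=
  {lam | ∃ mu : ℂ, ∃ a ∈ F, ∃ b ∈ F,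
    (LinearIndependent ℂ ![a, b] ∨ (a ≠ 0 ∧ mu = 0)) ∧ lam • a + mu • b ∈ F}

/-- `L(F)`, the maximum of the moduli of these coefficients. -/
def coeffBound (F : Finset A) : ℝ := sSup ((fun z : ℂ => ‖z‖) '' coeffs F)

/-- The set whose supremum is `L(F)` is finite, so `L(F)` is a genuine maximum. -/
theorem coeffs_finite (F : Finset A) : (coeffs F).Finite := by
  have key : ∀ a b c : A, {lam : ℂ | ∃ mu : ℂ,
      (LinearIndependent ℂ ![a, b] ∨ (a ≠ 0 ∧ mu = 0)) ∧ lam • a + mu • b = c}.Subsingleton := by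
    rintro a b c x ⟨mu, hx, hxc⟩ y ⟨nu, hy, hyc⟩
    have e : (x - y) • a + (mu - nu) • b = 0 := by
      have e' : (x - y) • a + (mu - nu) • b = (x • a + mu • b) - (y • a + nu • b) := by module
      rw [e', hxc, hyc, sub_self]
    by_cases hli : LinearIndependent ℂ ![a, b]
    · exact sub_eq_zero.1 (LinearIndependent.pair_iff.1 hli _ _ e).1
    · obtain ⟨ha, rfl⟩ := hx.resolve_left hli
      obtain ⟨-, rfl⟩ := hy.resolve_left hli
      simpa [ha, sub_eq_zero] using e
  refine Set.Finite.subset (s := ⋃ a ∈ F, ⋃ b ∈ F, ⋃ c ∈ F, {lam : ℂ | ∃ mu : ℂ,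
      (LinearIndependent ℂ ![a, b] ∨ (a ≠ 0 ∧ mu = 0)) ∧ lam • a + mu • b = c}) ?_ ?_
  · exact F.finite_toSet.biUnion fun a _ => F.finite_toSet.biUnion fun b _ =>
      F.finite_toSet.biUnion fun c _ => (key a b c).finite
  · rintro z ⟨mu, a, ha, b, hb, h, hab⟩
    simp only [Set.mem_iUnion]
    exact ⟨a, ha, b, hb, _, hab, mu, h, rfl⟩

theorem coeffBound_mono {F G : Finset A} (hFG : F ⊆ G) (hF : (coeffs F).Nonempty) :
    coeffBound F ≤ coeffBound G := by
  refine csSup_le_csSup ((coeffs_finite G).image _).bddAbove (hF.image _) (Set.image_mono ?_)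
  rintro z ⟨mu, a, ha, b, hb, h, hab⟩
  exact ⟨mu, a, hFG ha, b, hFG hb, h, hFG hab⟩

/-- The constant `M_p = max {3‖a‖, 3‖ψ_p(a)‖, L(F_p) : a ∈ F_p}`. -/
def normBound (F : Finset A) (ψ : A → Op) : ℝ :=
  sSup ((fun a => 3 * ‖a‖) '' (F : Set A) ∪ (fun a => 3 * ‖ψ a‖) '' (F : Set A) ∪ {coeffBound F})

/-- `(kp, Φ)` is a promise for `(F, ε, h, R, ψ)`. -/
structure IsPromise (X : Params) (F : Finset A) (ε : ℚ) (h : Op) (ψ : A → Op)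
    (kp : Op) (Φ : genCStar F →⋆ₐ[ℂ] Op) : Prop where
  faithful : Function.Injective Φ
  essential : ∀ x, IsCompactOperator (Φ x) → Φ x = 0
  isStarProjection : IsStarProjection kp
  le_low : kp ≤ low h
  eq_low : ∃ k ∈ X.C, kp = low k
  map_one : ψ 1 = high h
  close : ∀ (a : A) (ha : a ∈ F),
    ‖(ψ a - Φ ⟨a, mem_genCStar ha⟩) * (high h - kp)‖ < (ε : ℝ) / (3 * normBound F ψ)
  bounded : ∀ (a : A) (ha : a ∈ F),
    ‖ψ a + Φ ⟨a, mem_genCStar ha⟩ * (1 - high h)‖ < 3 / 2 * ‖a‖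
  map_kp : ∀ a ∈ F, MapsRange (ψ a) kp (low h)
  map_low : ∀ a ∈ F, MapsRange (ψ a) (low h) (high h)
  rep_kp : ∀ (a : A) (ha : a ∈ F), MapsRange (Φ ⟨a, mem_genCStar ha⟩) kp (low h)
  rep_low : ∀ (a : A) (ha : a ∈ F), MapsRange (Φ ⟨a, mem_genCStar ha⟩) (low h) (high h)

/-- The conditions `p = (F_p, ε_p, h_p, R_p, ψ_p)`, the elements of `𝔼_A`. A map `ψ_p` on `F_p` is
encoded as a map on `A` that vanishes outside `F_p`. -/
@[ext]
structure Condition (X : Params) (A : Type*) [CStarAlgebra A] where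
  F : Finset A
  ε : ℚ
  h : Op
  R : Op
  ψ : A → Op
  one_mem : 1 ∈ F
  star_mem : ∀ a ∈ F, star a ∈ F
  ε_pos : 0 < ε
  h_mem : h ∈ X.C
  R_mem : R ∈ Set.range X.proj
  ψ_mem : ∀ a ∈ F, ψ a ∈ X.D R h
  ψ_off : ∀ a, a ∉ F → ψ a = 0
  promise : ∃ (kp : Op) (Φ : genCStar F →⋆ₐ[ℂ] Op), IsPromise X F ε h ψ kp Φ

/-- `Δ^{p,+}_{a,b,lam,mu}`. -/
def deltaAdd (ψ : A → Op) (a b : A) (lam mu : ℂ) : Op :=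
  ψ (lam • a + mu • b) - lam • ψ a - mu • ψ b

/-- `Δ^{p,*}_a`. -/
def deltaStar (ψ : A → Op) (a : A) : Op := ψ (star a) - star (ψ a)

/-- `Δ^{p,·}_{a,b}`. -/
def deltaMul (ψ : A → Op) (a b : A) : Op := ψ (a * b) - ψ a * ψ b

/-- `p` is (strictly) stronger than `q`. -/
structure Stronger {X : Params} (p q : Condition X A) : Prop where
  F_sub : q.F ⊆ p.F
  ε_lt : p.ε < q.ε
  h_way : WayAbove p.h q.h
  R_le : q.R ≤ p.R
  ψ_high : ∀ a ∈ q.F, p.ψ a * high q.h = q.ψ a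
  low_ψ : ∀ a ∈ q.F, low q.h * p.ψ a = low q.h * q.ψ a
  add_lt : ∀ a ∈ q.F, ∀ b ∈ q.F, ∀ lam mu : ℂ, lam • a + mu • b ∈ q.F →
    ‖lam‖ ≤ coeffBound q.F → ‖mu‖ ≤ coeffBound q.F →
    ‖deltaAdd p.ψ a b lam mu * (low p.h - low q.h)‖ < (q.ε : ℝ) - p.ε
  star_lt : ∀ a ∈ q.F, ‖deltaStar p.ψ a * (low p.h - low q.h)‖ < (q.ε : ℝ) - p.ε
  mul_lt : ∀ a ∈ q.F, ∀ b ∈ q.F, a * b ∈ q.F →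
    ‖deltaMul p.ψ a b * (low p.h - low q.h)‖ < (q.ε : ℝ) - p.ε

/-! Facts needed to see that `Stronger` is a strict partial order. -/

theorem low_apply_of_fixed {h : Op} {ξ : Hilb} (hξ : h ξ = ξ) : low h ξ = ξ := by
  refine Submodule.starProjection_eq_self_iff.2 ?_
  simp [LinearMap.mem_ker, hξ]

theorem fixed_low (h : Op) (ξ : Hilb) : h (low h ξ) = low h ξ := by
  have h1 : low h ξ ∈ LinearMap.ker (h - 1).toLinearMap :=
    Submodule.starProjection_apply_mem _ _
  simpa [sub_eq_zero] using h1

theorem high_apply (h : Op) (ξ : Hilb) : high h (h ξ) = h ξ :=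
  Submodule.starProjection_eq_self_iff.2 (Submodule.le_topologicalClosure _ ⟨ξ, rfl⟩)

theorem high_mul_low (h : Op) : high h * low h = low h := by
  ext1 ξ
  have := high_apply h (low h ξ)
  rw [fixed_low] at this
  exact this

theorem high_mul_high {h g : Op} (hg : WayAbove h g) : high h * high g = high g := by
  ext1 ξ
  refine Submodule.starProjection_eq_self_iff.2 ?_
  refine Submodule.topologicalClosure_mono ?_ (Submodule.starProjection_apply_mem _ ξ)
  rintro _ ⟨η, rfl⟩
  exact ⟨g η, congrArg (fun T : Op => T η) hg⟩

theorem low_mul_low {h g : Op} (hg : WayAbove h g) : low h * low g = low g := by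
  ext1 ξ
  refine low_apply_of_fixed ?_
  have := congrArg (fun T : Op => T (low g ξ)) hg
  simpa [fixed_low] using this

theorem star_low (h : Op) : star (low h) = low h :=
  (isSelfAdjoint_starProjection _).star_eq

theorem low_mul_low' {h g : Op} (hg : WayAbove h g) : low g * low h = low g := by
  have := congrArg star (low_mul_low hg)
  rwa [star_mul, star_low, star_low] at this

theorem low_idem (h : Op) : low h * low h = low h := by
  ext1 ξ
  exact low_apply_of_fixed (fixed_low h ξ)

theorem high_mul_of_mapsRange {T h : Op} (hT : MapsRange T (low h) (high h)) :
    high h * (T * low h) = T * low h := by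
  ext1 ξ
  obtain ⟨η, hη⟩ := hT ⟨ξ, rfl⟩
  change high h (T (low h ξ)) = T (low h ξ)
  rw [← hη]
  exact Submodule.starProjection_eq_self_iff.2 (Submodule.starProjection_apply_mem _ _)

theorem Condition.coeffs_nonempty {X : Params} (p : Condition X A) : (coeffs p.F).Nonempty := by
  obtain ⟨kp, Φ, hP⟩ := p.promise
  have h1 : (1 : A) ≠ 0 := by
    intro h
    have := (norm_nonneg _).trans_lt (hP.bounded 1 p.one_mem)
    simp [h] at this
  exact ⟨1, 0, 1, p.one_mem, 1, p.one_mem, Or.inr ⟨h1, rfl⟩, by simpa using p.one_mem⟩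

theorem Condition.mapsRange_low {X : Params} (p : Condition X A) {a : A} (ha : a ∈ p.F) :
    MapsRange (p.ψ a) (low p.h) (high p.h) := by
  obtain ⟨kp, Φ, hP⟩ := p.promise
  exact hP.map_low a ha

theorem norm_split_lt {T E₁ E₂ E₃ : Op} {T' : Op} {x y z : ℝ}
    (h₁ : ‖T * (E₁ - E₂)‖ < y - x) (h₂ : ‖T' * (E₂ - E₃)‖ < z - y)
    (h : T * (E₂ - E₃) = T' * (E₂ - E₃)) : ‖T * (E₁ - E₃)‖ < z - x := by
  have : T * (E₁ - E₃) = T * (E₁ - E₂) + T' * (E₂ - E₃) := by rw [← h]; noncomm_ring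
  rw [this]
  linarith [norm_add_le (T * (E₁ - E₂)) (T' * (E₂ - E₃))]

theorem Stronger.trans {X : Params} {p q s : Condition X A}
    (hpq : Stronger p q) (hqs : Stronger q s) : Stronger p s := by
  have hw : WayAbove p.h s.h := by
    have h1 := hpq.h_way
    have h2 := hqs.h_way
    unfold WayAbove at *
    rw [← h2, ← mul_assoc, h1]
  have hE : low q.h - low s.h = low q.h * (low q.h - low s.h) := by
    rw [mul_sub, low_idem, low_mul_low hqs.h_way]
  have hψ : ∀ c ∈ q.F, p.ψ c * (low q.h - low s.h) = q.ψ c * (low q.h - low s.h) := by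
    intro c hc
    have h1 : p.ψ c * low q.h = q.ψ c * low q.h := by
      conv_lhs => rw [← high_mul_low, ← mul_assoc, hpq.ψ_high c hc]
    rw [hE, ← mul_assoc, h1, mul_assoc]
  have hst : ∀ c ∈ q.F, star (p.ψ c) * (low q.h - low s.h) =
      star (q.ψ c) * (low q.h - low s.h) := by
    intro c hc
    have h1 := congrArg star (hpq.low_ψ c hc)
    rw [star_mul, star_mul, star_low] at h1
    rw [hE, ← mul_assoc, h1, mul_assoc]
  refine ⟨hqs.F_sub.trans hpq.F_sub, hpq.ε_lt.trans hqs.ε_lt, hw, hqs.R_le.trans hpq.R_le,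
    fun a ha => ?_, fun a ha => ?_, fun a ha b hb lam mu hab hlam hmu => ?_, fun a ha => ?_,
    fun a ha b hb hab => ?_⟩
  · rw [← high_mul_high hqs.h_way, ← mul_assoc, hpq.ψ_high a (hqs.F_sub ha), hqs.ψ_high a ha]
  · rw [← low_mul_low' hqs.h_way, mul_assoc, hpq.low_ψ a (hqs.F_sub ha), ← mul_assoc,
      low_mul_low' hqs.h_way, hqs.low_ψ a ha]
  · have hL := coeffBound_mono hqs.F_sub s.coeffs_nonempty
    refine norm_split_lt (hpq.add_lt a (hqs.F_sub ha) b (hqs.F_sub hb) lam mu (hqs.F_sub hab)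
      (hlam.trans hL) (hmu.trans hL)) (hqs.add_lt a ha b hb lam mu hab hlam hmu) ?_
    simp only [deltaAdd, sub_mul, smul_mul_assoc]
    rw [hψ _ (hqs.F_sub hab), hψ _ (hqs.F_sub ha), hψ _ (hqs.F_sub hb)]
  · refine norm_split_lt (hpq.star_lt a (hqs.F_sub ha)) (hqs.star_lt a ha) ?_
    simp only [deltaStar, sub_mul]
    rw [hψ _ (hqs.F_sub (s.star_mem a ha)), hst _ (hqs.F_sub ha)]
  · refine norm_split_lt (hpq.mul_lt a (hqs.F_sub ha) b (hqs.F_sub hb) (hqs.F_sub hab))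
      (hqs.mul_lt a ha b hb hab) ?_
    have h2 : q.ψ b * (low q.h - low s.h) = high q.h * (q.ψ b * (low q.h - low s.h)) := by
      have := high_mul_of_mapsRange (q.mapsRange_low (hqs.F_sub hb))
      rw [hE, ← mul_assoc, ← mul_assoc, this]
    simp only [deltaMul, sub_mul _ _ (low q.h - low s.h), mul_assoc]
    rw [hψ _ (hqs.F_sub hab), hψ _ (hqs.F_sub hb), h2, ← mul_assoc (p.ψ a),
      hpq.ψ_high a (hqs.F_sub ha), ← h2]

theorem Stronger.irrefl {X : Params} (p : Condition X A) : ¬ Stronger p p :=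
  fun h => lt_irrefl _ h.ε_lt

/-- The poset `𝔼_A`: `p < q` means that `p` is stronger than `q`, and `p ≤ q` that `p < q` or
`p = q`. -/
instance (X : Params) : PartialOrder (Condition X A) where
  le p q := Stronger p q ∨ p = q
  lt p q := Stronger p q
  le_refl p := Or.inr rfl
  le_trans p q s := by
    rintro (h | rfl) (h' | rfl)
    · exact Or.inl (h.trans h')
    · exact Or.inl h
    · exact Or.inl h'
    · exact Or.inr rfl
  le_antisymm p q := by
    rintro (h | rfl) (h' | h')
    · exact absurd (h.trans h') (Stronger.irrefl p)
    · exact h'.symm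
    · rfl
    · rfl
  lt_iff_le_not_ge p q := by
    constructor
    · intro h
      refine ⟨Or.inl h, ?_⟩
      rintro (h' | rfl)
      · exact Stronger.irrefl p (h.trans h')
      · exact Stronger.irrefl _ h
    · rintro ⟨h | rfl, h'⟩
      · exact h
      · exact absurd (Or.inr rfl) h'

/-- A subset of a poset is open dense if it is closed downwards and every element of the poset has
an element of the subset below it. -/
def IsOpenDense {P : Type*} [PartialOrder P] (S : Set P) : Prop :=
  (∀ p ∈ S, ∀ q, q ≤ p → q ∈ S) ∧ ∀ p, ∃ q ∈ S, q ≤ p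

/-- The set `𝒟_{F,ε,h,R}` of conditions. -/
def denseSet (X : Params) (F : Finset A) (ε : ℚ) (h R : Op) : Set (Condition X A) :=
  {p | F ⊆ p.F ∧ p.ε ≤ ε ∧ WayAbove p.h h ∧ R ≤ p.R}

end

end CalkinForcing

/-!
Openness is transitivity of `≫` and of inclusion; the content is density.

Let `q` be a condition, with promise `(k_q, Φ)`, and let `G` be the given finite set together with
`F_q` and adjoints. A stronger condition is read off from a representation of `C⋆(G)` that continues
`Φ`, and there are two things to arrange: the representation has to exist, and it has to be aligned
with the countable sets of parameters.

*Existence.* Vector functionals of `Φ` extend to positive functionals on `A` (M. Riesz extension).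
Decomposing `Φ` into cyclic pieces and summing the GNS representations of the extended functionals
gives a representation of all of `A` on a space containing the original one
(`exists_extension`). It is faithful as `A` is simple. Amplifying it infinitely often
and cutting down to a separable invariant subspace gives a faithful essential representation of
`C⋆(G)` on `ℓ₂(ℕ)`, with an isometry `J` that intertwines it with `Φ` on `F_q`
(`exists_essential_extension`).

*Alignment.* Let `k ∈ C` be above everything given. The new representation is conjugated
by a unitary `W` such that `W J` is the identity on the fixed space of `k`
(`exists_unitary_adjusting`). All data of `q` live on this finite-dimensional space, so every clause
of the promise of `q` holds verbatim for the new representation; the clause that involves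
`1 - h_q⁺`, and so the whole space, is `norm_add_mul_one_sub_le`. No approximate unitary equivalence
is needed. The rest of `W` is free, and is used to find `h ∈ C`, `h ≫ k`, such that the conjugated
representation `π` maps the fixed space of `k` into that of `h`, and that into the range of
`h`. This uses elements of `C` whose fixed space is known exactly and whose range is
large (`exists_mem_C_fixed_eq`), obtained by approximating a mean of two projections.

*The new condition.* Take `h`, a large `R`, `k_p = k⁻` and, for `a ∈ F_q`, a member of `D_{R,h}` close
to `ψ_q(a) + S_{R,h} π(a) (h⁺ - h_q⁺)` that agrees exactly with `ψ_q(a)` where it has to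
(`exists_mem_D_of_old`); for the other `a ∈ G` approximate `S_{R,h} π(a) h⁺`
(`exists_mem_D_of_new`). On `h⁺ - k_q` the new map is as close to `π` as `ψ_q` is to
`Φ` on `h_q⁺ - k_q`, up to an arbitrarily small error. As `π` is multiplicative, linear
and self-adjoint, the new map is nearly so, and the factor `3 M_q` in the promise of `q` pays for the
accumulated errors (`Stronger.of_estimates`).
-/

namespace CalkinForcing

open scoped ComplexOrder InnerProductSpace ENNReal

/-! ### Extension of vector functionals and representations -/

section Extension

variable {A : Type*} [CStarAlgebra A]
variable {H : Type*} [NormedAddCommGroup H] [InnerProductSpace ℂ H] [CompleteSpace H]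

/-- A vector functional of a representation of a closed star subalgebra extends to a positive linear
functional on the whole algebra. The M. Riesz extension theorem is applied to the real part and the
cone of elements with positive real part. -/
theorem exists_positive_extension [PartialOrder A] [StarOrderedRing A]
    (C : StarSubalgebra ℂ A) [IsClosed (C : Set A)] (Φ : C →⋆ₐ[ℂ] (H →L[ℂ] H)) (w : H) :
    ∃ g : A →ₚ[ℂ] ℂ, ∀ c : C, g c = ⟪w, Φ c w⟫_ℂ := by
  let s : PointedCone ℝ A :=
    { carrier := {x | 0 ≤ x + star x}
      add_mem' := by
        intro x y hx hy
        have : (x + y) + star (x + y) = (x + star x) + (y + star y) := by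
          rw [star_add]; abel
        simpa only [Set.mem_ofPred_eq, this] using add_nonneg hx hy
      zero_mem' := by simp
      smul_mem' := by
        intro r x hx
        have : (r : ℝ) • x + star ((r : ℝ) • x) = (r : ℝ) • (x + star x) := by
          rw [star_smul, smul_add]; simp
        change 0 ≤ (r : ℝ) • x + star ((r : ℝ) • x)
        rw [this]
        exact smul_nonneg r.2 hx }
  let φ : C →ₗ[ℂ] ℂ :=
    { toFun := fun c => ⟪w, Φ c w⟫_ℂ
      map_add' := by intro c d; simp
      map_smul' := by intro r c; simp }
  let f : A →ₗ.[ℝ] ℝ :=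
    { domain := (Subalgebra.toSubmodule C.toSubalgebra).restrictScalars ℝ
      toFun := Complex.reLm ∘ₗ (φ.restrictScalars ℝ) }
  have hf : ∀ c : C, f ⟨c, c.2⟩ = (⟪w, Φ c w⟫_ℂ).re := fun c => rfl
  obtain ⟨g, hgf, hgs⟩ := riesz_extension s f
    (by
      rintro ⟨x, hxC⟩ hx
      replace hx : 0 ≤ x + star x := hx
      have hxC' : x ∈ C := hxC
      set y := CFC.sqrt (x + star x) with hy
      have hyC : y ∈ C := by
        rw [hy, CFC.sqrt_eq_real_sqrt _ hx, cfcₙ_eq_cfc]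
        exact cfc_mem _ (add_mem hxC' (star_mem hxC'))
      have hysa : star y = y := (CFC.sqrt_nonneg (x + star x)).isSelfAdjoint
      have hyy : y * y = x + star x := CFC.sqrt_mul_sqrt_self _ hx
      have key : (star (⟨y, hyC⟩ : C)) * ⟨y, hyC⟩ = ⟨x, hxC'⟩ + star (⟨x, hxC'⟩ : C) := by
        ext; simp [hysa, hyy]
      have key2 := congrArg (fun c => (⟪w, Φ c w⟫_ℂ).re) key
      simp only [map_mul, map_add, map_star, ContinuousLinearMap.star_eq_adjoint,
        mul_apply_eq_comp, ContinuousLinearMap.adjoint_inner_right,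
        add_apply, inner_add_right, Complex.add_re] at key2
      have e2 : (⟪Φ ⟨x, hxC'⟩ w, w⟫_ℂ).re = (⟪w, Φ ⟨x, hxC'⟩ w⟫_ℂ).re := by
        rw [← inner_conj_symm, Complex.conj_re]
      have e3 : 0 ≤ (⟪Φ ⟨y, hyC⟩ w, Φ ⟨y, hyC⟩ w⟫_ℂ).re := inner_self_nonneg (𝕜 := ℂ)
      rw [e2] at key2
      have := hf ⟨x, hxC'⟩
      simp only at this
      rw [this]
      linarith)
    (by
      intro y
      refine ⟨⟨algebraMap ℂ A (‖y + star y‖ : ℝ), algebraMap_mem C _⟩, ?_⟩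
      change 0 ≤ (algebraMap ℂ A (‖y + star y‖ : ℝ) + y) +
        star (algebraMap ℂ A (‖y + star y‖ : ℝ) + y)
      have hsa : IsSelfAdjoint (y + star y) := IsSelfAdjoint.add_star_self y
      have h1 := hsa.neg_algebraMap_norm_le_self
      have h2 : (0 : A) ≤ algebraMap ℝ A ‖y + star y‖ := by
        rw [Algebra.algebraMap_eq_smul_one]
        exact smul_nonneg (norm_nonneg _) zero_le_one
      have e : algebraMap ℂ A (‖y + star y‖ : ℝ) = algebraMap ℝ A ‖y + star y‖ := by
        rw [Algebra.algebraMap_eq_smul_one, Algebra.algebraMap_eq_smul_one, Complex.coe_smul]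
      have e' : star (algebraMap ℝ A ‖y + star y‖) = algebraMap ℝ A ‖y + star y‖ := by
        rw [Algebra.algebraMap_eq_smul_one, star_smul]; simp
      rw [e, star_add, e']
      have e3 : algebraMap ℝ A ‖y + star y‖ + y + (algebraMap ℝ A ‖y + star y‖ + star y)
        = algebraMap ℝ A ‖y + star y‖ + (y + star y - -algebraMap ℝ A ‖y + star y‖) := by abel
      rw [e3]
      exact add_nonneg h2 (sub_nonneg.2 h1))
  let G : A →ₗ[ℂ] ℂ := Module.Dual.extendRCLike (𝕜 := ℂ) g
  have hG : ∀ x, G x = (g x : ℂ) - Complex.I * (g (Complex.I • x) : ℂ) := fun x => rfl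
  refine ⟨PositiveLinearMap.mk₀ G fun x hx => ?_, fun c => ?_⟩
  · have hsa : star x = x := hx.isSelfAdjoint
    have h0 : 0 ≤ g x := hgs _ (by change 0 ≤ x + star x; rw [hsa]; exact add_nonneg hx hx)
    have h1 : 0 ≤ g (Complex.I • x) := hgs _ (by
      change 0 ≤ _ + star _; simp [star_smul, hsa])
    have h2 : 0 ≤ g (-(Complex.I • x)) := hgs _ (by
      change 0 ≤ _ + star _; simp [star_smul, hsa])
    rw [map_neg] at h2
    have h3 : g (Complex.I • x) = 0 := by linarith
    rw [hG, h3]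
    simpa using h0
  · change G c = _
    have h1 := hgf ⟨c, c.2⟩
    have h2 := hgf ⟨(Complex.I • c : C), (Complex.I • c : C).2⟩
    rw [hf] at h1 h2
    replace h2 : g (Complex.I • (c : A)) = _ := h2
    rw [hG, h1, h2]
    apply Complex.ext <;> simp

/-- The Hilbert space direct sum of a family of representations. -/
noncomputable def directSum {ι : Type*} {K : ι → Type*} [∀ i, NormedAddCommGroup (K i)]
    [∀ i, InnerProductSpace ℂ (K i)] [∀ i, CompleteSpace (K i)]
    (π : ∀ i, A →⋆ₐ[ℂ] (K i →L[ℂ] K i)) : A →⋆ₐ[ℂ] (lp K 2 →L[ℂ] lp K 2) where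
  toFun a := lp.mapCLM 2 (fun i => π i a) (norm_nonneg a)
    fun i => NonUnitalStarAlgHom.norm_apply_le (π i) a
  map_one' := by ext; simp
  map_mul' a b := by ext; simp
  map_zero' := by ext; simp
  map_add' a b := by ext; simp
  commutes' r := by ext; simp [Algebra.algebraMap_eq_smul_one]
  map_star' a := by
    rw [ContinuousLinearMap.star_eq_adjoint, ContinuousLinearMap.eq_adjoint_iff]
    intro x y
    rw [lp.inner_eq_tsum, lp.inner_eq_tsum]
    refine tsum_congr fun i => ?_
    simp [map_star, ContinuousLinearMap.star_eq_adjoint, ContinuousLinearMap.adjoint_inner_left]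

theorem directSum_apply {ι : Type*} {K : ι → Type*} [∀ i, NormedAddCommGroup (K i)]
    [∀ i, InnerProductSpace ℂ (K i)] [∀ i, CompleteSpace (K i)]
    (π : ∀ i, A →⋆ₐ[ℂ] (K i →L[ℂ] K i)) (a : A) (x : lp K 2) (i : ι) :
    directSum π a x i = π i a (x i) := rfl

theorem directSum_single {ι : Type*} [DecidableEq ι] {K : ι → Type*}
    [∀ i, NormedAddCommGroup (K i)]
    [∀ i, InnerProductSpace ℂ (K i)] [∀ i, CompleteSpace (K i)]
    (π : ∀ i, A →⋆ₐ[ℂ] (K i →L[ℂ] K i)) (a : A) (i : ι) (x : K i) :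
    directSum π a (lp.single 2 i x) = lp.single 2 i (π i a x) := by
  ext j
  rw [directSum_apply]
  by_cases h : j = i
  · subst h; simp
  · rw [lp.single_apply_ne _ _ _ h, lp.single_apply_ne _ _ _ h, map_zero]

omit [CompleteSpace H] in
/-- Families with the same Gram matrix are related by a linear isometry, defined everywhere if the
first family is total. -/
theorem exists_isometry_of_gram {I K : Type*} [NormedAddCommGroup K] [InnerProductSpace ℂ K]
    [CompleteSpace K] (x : I → H) (y : I → K)
    (hxy : ∀ i j, ⟪x i, x j⟫_ℂ = ⟪y i, y j⟫_ℂ)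
    (hx : (Submodule.span ℂ (Set.range x)).topologicalClosure = ⊤) :
    ∃ J : H →ₗᵢ[ℂ] K, ∀ i, J (x i) = y i := by
  let Tx := Finsupp.linearCombination ℂ x
  let Ty := Finsupp.linearCombination ℂ y
  have hinner : ∀ f, ⟪Tx f, Tx f⟫_ℂ = ⟪Ty f, Ty f⟫_ℂ := by
    intro f
    simp only [Tx, Ty, Finsupp.linearCombination_apply, Finsupp.sum, sum_inner, inner_sum,
      inner_smul_left, inner_smul_right, hxy]
  have hnorm : ∀ f, ‖Ty f‖ = ‖Tx f‖ := by
    intro f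
    rw [@norm_eq_sqrt_re_inner ℂ, @norm_eq_sqrt_re_inner ℂ, hinner]
  have hd : DenseRange Tx := by
    rw [DenseRange, ← LinearMap.coe_range, Finsupp.range_linearCombination,
      Submodule.dense_iff_topologicalClosure_eq_top]
    exact hx
  have hb : ∃ C, ∀ f, ‖Ty f‖ ≤ C * ‖Tx f‖ := ⟨1, fun f => by rw [one_mul, hnorm]⟩
  have he := Ty.extendOfNorm_eq hd hb
  refine ⟨⟨(Ty.extendOfNorm Tx).toLinearMap, fun v => ?_⟩, fun i => ?_⟩
  · refine hd.induction_on (p := fun v => ‖Ty.extendOfNorm Tx v‖ = ‖v‖) v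
      (isClosed_eq (by fun_prop) (by fun_prop)) fun f => ?_
    rw [he, hnorm]
  · have := he (Finsupp.single i 1)
    simpa [Tx, Ty] using this

/-- Every representation is a Hilbert space direct sum of cyclic ones: there is a total family of
mutually orthogonal orbits. -/
theorem exists_orthogonal_cyclic {C : Type*} [Ring C] [StarRing C] [Algebra ℂ C]
    (Φ : C →⋆ₐ[ℂ] (H →L[ℂ] H)) :
    ∃ S : Set H, (∀ w ∈ S, ∀ w' ∈ S, w ≠ w' → ∀ c, ⟪Φ c w, w'⟫_ℂ = 0) ∧
      (Submodule.span ℂ (Set.range fun p : C × S => Φ p.1 p.2)).topologicalClosure = ⊤ := by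
  obtain ⟨S, hS⟩ := zorn_subset
    {S : Set H | ∀ w ∈ S, ∀ w' ∈ S, w ≠ w' → ∀ c, ⟪Φ c w, w'⟫_ℂ = 0} (by
      intro 𝒮 h𝒮 hch
      refine ⟨⋃₀ 𝒮, ?_, fun s hs => Set.subset_sUnion_of_mem hs⟩
      rintro w ⟨s, hs, hw⟩ w' ⟨t, ht, hw'⟩ hne c
      rcases hch.total hs ht with h | h
      · exact h𝒮 ht w (h hw) w' hw' hne c
      · exact h𝒮 hs w hw w' (h hw') hne c)
  refine ⟨S, hS.prop, ?_⟩
  rw [Submodule.topologicalClosure_eq_top_iff, Submodule.eq_bot_iff]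
  intro v hv
  have hv' : ∀ c, ∀ w ∈ S, ⟪Φ c w, v⟫_ℂ = 0 := fun c w hw =>
    (Submodule.mem_orthogonal _ _).1 hv _ (Submodule.subset_span ⟨(c, ⟨w, hw⟩), rfl⟩)
  have hins : insert v S ⊆ S := by
    refine hS.le_of_ge (y := insert v S) ?_ (Set.subset_insert _ _)
    rintro w (rfl | hw) w' (rfl | hw') hne c
    · exact absurd rfl hne
    · rw [← ContinuousLinearMap.adjoint_inner_right, ← ContinuousLinearMap.star_eq_adjoint,
        ← map_star, ← inner_conj_symm, hv' _ _ hw', map_zero]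
    · exact hv' c w hw
    · exact hS.prop w hw w' hw' hne c
  have := hv' 1 v (hins (Set.mem_insert _ _))
  simpa using this

end Extension

section Extension

universe u
variable {A : Type u} [CStarAlgebra A]
variable {H : Type} [NormedAddCommGroup H] [InnerProductSpace ℂ H] [CompleteSpace H]

/-- A representation of a closed star subalgebra on `H` extends to a representation of the whole
algebra on a larger Hilbert space, of which `H` is a reducing subspace for the subalgebra. -/
theorem exists_extension (C : StarSubalgebra ℂ A) [IsClosed (C : Set A)]
    (Φ : C →⋆ₐ[ℂ] (H →L[ℂ] H)) :
    ∃ (K : Type u) (_ : NormedAddCommGroup K) (_ : InnerProductSpace ℂ K) (_ : CompleteSpace K)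
      (π : A →⋆ₐ[ℂ] (K →L[ℂ] K)) (J : H →ₗᵢ[ℂ] K), ∀ (c : C) (v : H), π c (J v) = J (Φ c v) := by
  classical
  let _ := CStarAlgebra.spectralOrder A
  let _ := CStarAlgebra.spectralOrderedRing A
  obtain ⟨S, hS, hSt⟩ := exists_orthogonal_cyclic Φ
  choose g hg using exists_positive_extension C Φ
  let K : S → Type u := fun w => (g w).GNS
  let π : A →⋆ₐ[ℂ] (lp K 2 →L[ℂ] lp K 2) := directSum fun w : S => (g w).gnsStarAlgHom
  let ξ : ∀ w : S, K w := fun w => (((g w).toPreGNS 1 : (g w).PreGNS) : (g w).GNS)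
  have hπξ : ∀ (w : S) (a : A), (g w).gnsStarAlgHom a (ξ w) =
      (((g w).toPreGNS a : (g w).PreGNS) : (g w).GNS) := by
    intro w a
    simp [ξ]
  let x : C × S → H := fun p => Φ p.1 p.2
  let y : C × S → lp K 2 := fun p => lp.single 2 p.2 ((g p.2).gnsStarAlgHom (p.1 : A) (ξ p.2))
  have hxy : ∀ p q, ⟪x p, x q⟫_ℂ = ⟪y p, y q⟫_ℂ := by
    rintro ⟨c, w⟩ ⟨d, w'⟩
    have e1 : ⟪x (c, w), x (d, w')⟫_ℂ = ⟪(w : H), Φ (star c * d) w'⟫_ℂ := by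
      simp [x, map_star, ContinuousLinearMap.star_eq_adjoint,
        ContinuousLinearMap.adjoint_inner_right]
    rw [e1]
    simp only [y]
    rw [lp.inner_single_left]
    by_cases h : w = w'
    · subst h
      rw [lp.single_apply_self, hπξ, hπξ, UniformSpace.Completion.inner_coe,
        PositiveLinearMap.preGNS_inner_def, ← hg]
      simp
    · rw [lp.single_apply_ne _ _ _ h, inner_zero_right, ← inner_conj_symm,
        hS _ w'.2 _ w.2 (fun e => h (Subtype.ext e.symm)), map_zero]
  obtain ⟨J, hJ⟩ := exists_isometry_of_gram x y hxy hSt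
  refine ⟨lp K 2, inferInstance, inferInstance, inferInstance, π, J, fun c v => ?_⟩
  have hd : Dense (Submodule.span ℂ (Set.range x) : Set H) :=
    Submodule.dense_iff_topologicalClosure_eq_top.2 hSt
  refine congrFun (Continuous.ext_on hd (f := fun v => π c (J v)) (g := fun v => J (Φ c v))
    (by fun_prop) (by fun_prop) ?_) v
  intro v hv
  induction hv using Submodule.span_induction with
  | mem v hv =>
    obtain ⟨⟨d, w⟩, rfl⟩ := hv
    have e : Φ c (x (d, w)) = x (c * d, w) := by simp [x]
    simp only
    rw [e, hJ, hJ]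
    simp only [y, π]
    rw [directSum_single, MulMemClass.coe_mul, map_mul]
    rfl
  | zero => simp
  | add v w _ _ hv hw => simp only [map_add] at *; rw [hv, hw]
  | smul r v _ hv => simp only [map_smul] at *; rw [hv]

end Extension

/-! ### Separable, faithful and essential representations -/

section Separable

/-- The restriction of a representation to a closed invariant subspace. -/
noncomputable def subRep {B : Type*} [Ring B] [StarRing B] [Algebra ℂ B]
    {L : Type*} [NormedAddCommGroup L] [InnerProductSpace ℂ L] [CompleteSpace L]
    (π : B →⋆ₐ[ℂ] (L →L[ℂ] L)) (M : Submodule ℂ L) [CompleteSpace M]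
    (hM : ∀ b, ∀ x ∈ M, π b x ∈ M) : B →⋆ₐ[ℂ] (M →L[ℂ] M) where
  toFun b := ((π b).comp M.subtypeL).codRestrict M fun x => hM b x x.2
  map_one' := by ext; simp
  map_mul' a b := by ext; simp; rfl
  map_zero' := by ext; simp
  map_add' a b := by ext; simp; rfl
  commutes' r := by ext; simp [Algebra.algebraMap_eq_smul_one]
  map_star' a := by
    rw [ContinuousLinearMap.star_eq_adjoint, ContinuousLinearMap.eq_adjoint_iff]
    intro x y
    simp [Submodule.coe_inner, map_star, ContinuousLinearMap.star_eq_adjoint,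
      ContinuousLinearMap.adjoint_inner_left]
    rfl

/-- A separable infinite-dimensional complex Hilbert space is isometric to `ℓ₂(ℕ)`. -/
theorem nonempty_linearIsometryEquiv_hilb (K : Type*) [NormedAddCommGroup K]
    [InnerProductSpace ℂ K] [CompleteSpace K] [TopologicalSpace.SeparableSpace K]
    (hK : ¬ FiniteDimensional ℂ K) : Nonempty (K ≃ₗᵢ[ℂ] Hilb) := by
  obtain ⟨w, b, hb⟩ := exists_hilbertBasis ℂ K
  have ho : Orthonormal ℂ ((↑) : w → K) := hb ▸ b.orthonormal
  have hdist : ∀ x ∈ w, ∀ y ∈ w, x ≠ y → 1 ≤ dist x y := by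
    intro x hx y hy hne
    have h0 : ⟪x, y⟫_ℂ = 0 := ho.2 (i := ⟨x, hx⟩) (j := ⟨y, hy⟩) (by simpa using hne)
    have h1 : ‖x‖ = 1 := ho.1 ⟨x, hx⟩
    have h2 : ‖x‖ ^ 2 ≤ ‖x‖ * ‖x - y‖ := by
      calc ‖x‖ ^ 2 = ‖⟪x, x - y⟫_ℂ‖ := by
            rw [inner_sub_right, h0, sub_zero, inner_self_eq_norm_sq_to_K]; simp
        _ ≤ _ := norm_inner_le_norm _ _
    rw [dist_eq_norm]
    simpa [h1] using h2
  have hcount : w.Countable := by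
    refine Set.PairwiseDisjoint.countable_of_isOpen (s := fun x => Metric.ball x (1 / 2)) ?_
      (fun _ _ => Metric.isOpen_ball) (fun x _ => ⟨x, Metric.mem_ball_self (by norm_num)⟩)
    intro x hx y hy hne
    refine Metric.ball_disjoint_ball ?_
    have := hdist x hx y hy hne
    norm_num
    exact this
  have hinf : w.Infinite := by
    intro hfin
    have := hfin.fintype
    exact hK (Module.Basis.finiteDimensional_of_finite b.toOrthonormalBasis.toBasis)
  have := hcount.to_subtype
  have := hinf.to_subtype
  obtain ⟨e⟩ : Nonempty (ℕ ≃ w) := nonempty_equiv_of_countable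
  have hr : Set.range (fun n => b (e n)) = Set.range b := e.surjective.range_comp b
  let b' : HilbertBasis ℕ ℂ K := HilbertBasis.mk (v := fun n => b (e n))
    (b.orthonormal.comp e e.injective) (by rw [hr, b.dense_span])
  exact ⟨b'.repr⟩

theorem isSeparable_genCStar {A : Type*} [CStarAlgebra A] (F : Finset A) :
    TopologicalSpace.IsSeparable (genCStar F : Set A) := by
  have hc : (Submonoid.closure ((F : Set A) ∪ star (F : Set A)) : Set A).Countable := by
    have hs : ((F : Set A) ∪ star (F : Set A)).Countable := by
      refine F.countable_toSet.union ?_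
      rw [← Set.image_star]
      exact F.countable_toSet.image _
    have := hs.to_subtype
    have hr : Set.range ((↑) : ((F : Set A) ∪ star (F : Set A) : Set A) → A) =
      (F : Set A) ∪ star (F : Set A) := Subtype.range_coe
    rw [← hr, ← FreeMonoid.mrange_lift, MonoidHom.coe_mrange]
    have : Countable (FreeMonoid ((F : Set A) ∪ star (F : Set A) : Set A)) :=
      inferInstanceAs (Countable (List _))
    exact Set.countable_range _
  have hs := (hc.isSeparable.span (R := ℂ)).closure
  have e : (genCStar F : Set A) = closure (Submodule.span ℂ
      (Submonoid.closure ((F : Set A) ∪ star (F : Set A)) : Set A) : Set A) := by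
    rw [← Algebra.adjoin_eq_span, genCStar, StarSubalgebra.topologicalClosure_coe]
    rfl
  rwa [e]

universe u in
/-- The infinite amplification of a representation: a representation `σ` on a space containing a
sequence of orthogonal copies of the given one. -/
theorem exists_amplification {A : Type*} [CStarAlgebra A] {K : Type u} [NormedAddCommGroup K]
    [InnerProductSpace ℂ K] [CompleteSpace K] (π : A →⋆ₐ[ℂ] (K →L[ℂ] K)) :
    ∃ (L : Type u) (_ : NormedAddCommGroup L) (_ : InnerProductSpace ℂ L) (_ : CompleteSpace L)
      (σ : A →⋆ₐ[ℂ] (L →L[ℂ] L)) (i : ℕ → K →ₗᵢ[ℂ] L),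
      (∀ a n x, σ a (i n x) = i n (π a x)) ∧ ∀ n m, n ≠ m → ∀ x, ‖x‖ ≤ ‖i n x - i m x‖ := by
  classical
  refine ⟨lp (fun _ : ℕ => K) 2, inferInstance, inferInstance, inferInstance,
    directSum fun _ => π, fun n =>
    { toLinearMap := lp.lsingle (𝕜 := ℂ) (E := fun _ : ℕ => K) 2 n
      norm_map' := fun x => lp.norm_single (E := fun _ : ℕ => K) (p := 2) (by norm_num) n x },
    fun a n x => directSum_single (fun _ : ℕ => π) a n x, fun n m hnm x => ?_⟩
  change ‖x‖ ≤ ‖lp.single (E := fun _ : ℕ => K) 2 n x - lp.single 2 m x‖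
  refine le_trans (le_of_eq ?_) (lp.norm_apply_le_norm (by norm_num) _ n)
  rw [lp.coeFn_sub, Pi.sub_apply, lp.single_apply_self, lp.single_apply_ne _ _ _ hnm, sub_zero]

/-- Countably many vectors suffice to separate the points of a separable set of elements: take, for
each member of a countable dense set, a vector at which its norm is nearly attained. -/
theorem exists_countable_separating {A : Type*} [CStarAlgebra A] {K : Type*} [NormedAddCommGroup K]
    [InnerProductSpace ℂ K] [CompleteSpace K] (π : A →⋆ₐ[ℂ] (K →L[ℂ] K))
    (hπ : Function.Injective π) {B : Set A} (hB : TopologicalSpace.IsSeparable B) :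
    ∃ Z : Set K, Z.Countable ∧ ∀ b ∈ B, b ≠ 0 → ∃ ζ ∈ Z, π b ζ ≠ 0 := by
  have hnorm : ∀ a, ‖π a‖ = ‖a‖ := fun a => NonUnitalStarAlgHom.norm_map π hπ a
  obtain ⟨c, hc, hcB⟩ := hB
  have hζ : ∀ a : A, ∃ ζ : K, a ≠ 0 → ‖ζ‖ < 1 ∧ ‖a‖ / 2 < ‖π a ζ‖ := by
    intro a
    by_cases ha : a = 0
    · exact ⟨0, fun h => absurd ha h⟩
    · have h0 : 0 < ‖a‖ := norm_pos_iff.2 ha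
      obtain ⟨ζ, h1, h2⟩ := (π a).exists_lt_apply_of_lt_opNorm (r := ‖a‖ / 2)
        (by rw [hnorm]; linarith)
      exact ⟨ζ, fun _ => ⟨h1, h2⟩⟩
  choose ζ hζ using hζ
  refine ⟨ζ '' c, hc.image _, fun b hb hb0 => ?_⟩
  have h0 : 0 < ‖b‖ := norm_pos_iff.2 hb0
  obtain ⟨a, ha, hab⟩ := Metric.mem_closure_iff.1 (hcB hb) (‖b‖ / 4) (by positivity)
  rw [dist_eq_norm] at hab
  have h1 : ‖b‖ ≤ ‖a‖ + ‖b - a‖ := by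
    have := norm_add_le a (b - a)
    rwa [add_sub_cancel] at this
  have ha0 : a ≠ 0 := by
    rintro rfl
    simp at h1 hab
    linarith
  obtain ⟨h2, h3⟩ := hζ a ha0
  refine ⟨ζ a, ⟨a, ha, rfl⟩, fun h => ?_⟩
  have h4 : ‖π (b - a) (ζ a)‖ ≤ ‖b - a‖ * 1 := by
    refine ((π (b - a)).le_opNorm _).trans ?_
    rw [hnorm]
    gcongr
  rw [map_sub, sub_apply, h, zero_sub, norm_neg] at h4
  linarith

/-- A separable set of vectors generates a separable closed invariant subspace under a separable
algebra of operators. -/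
theorem exists_separable_invariant {A : Type*} [CStarAlgebra A] {L : Type*} [NormedAddCommGroup L]
    [InnerProductSpace ℂ L] [CompleteSpace L] (σ : A →⋆ₐ[ℂ] (L →L[ℂ] L))
    (B : StarSubalgebra ℂ A) (hB : TopologicalSpace.IsSeparable (B : Set A))
    {Z : Set L} (hZ : TopologicalSpace.IsSeparable Z) :
    ∃ M : Submodule ℂ L, IsClosed (M : Set L) ∧ TopologicalSpace.IsSeparable (M : Set L) ∧
      Z ⊆ M ∧ ∀ b ∈ B, ∀ x ∈ M, σ b x ∈ M := by
  let T : Set L := (fun p : A × L => σ p.1 p.2) '' ((B : Set A) ×ˢ Z)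
  have hT : TopologicalSpace.IsSeparable T := by
    refine (hB.prod hZ).image ?_
    have h1 : Continuous fun b => σ b :=
      AddMonoidHomClass.continuous_of_bound σ 1 fun a => by
        rw [one_mul]; exact NonUnitalStarAlgHom.norm_apply_le σ a
    exact (h1.comp continuous_fst).clm_apply continuous_snd
  refine ⟨(Submodule.span ℂ T).topologicalClosure, Submodule.isClosed_topologicalClosure _,
    (hT.span (R := ℂ)).closure, fun z hz => ?_, fun b hb x hx => ?_⟩
  · exact Submodule.le_topologicalClosure _ (Submodule.subset_span
      ⟨(1, z), ⟨one_mem B, hz⟩, by simp⟩)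
  · have h1 : Set.MapsTo (σ b) (Submodule.span ℂ T) (Submodule.span ℂ T) := by
      intro y hy
      induction hy using Submodule.span_induction with
      | mem y hy =>
        obtain ⟨⟨c, z⟩, ⟨hc, hz⟩, rfl⟩ := hy
        exact Submodule.subset_span ⟨(b * c, z), ⟨mul_mem hb hc, hz⟩, by simp⟩
      | zero => simp
      | add y z _ _ hy hz => rw [map_add]; exact add_mem hy hz
      | smul r y _ hy => rw [map_smul]; exact Submodule.smul_mem _ _ hy
    exact h1.closure (σ b).continuous hx

/-- A faithful representation on an arbitrary Hilbert space yields, for a separable subalgebra, a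
faithful and essential representation on `ℓ₂(ℕ)` that extends a given separable part: amplify
infinitely many times, then cut down to a separable invariant subspace. -/
theorem exists_essential {A : Type*} [CStarAlgebra A] [Nontrivial A] {K : Type*}
    [NormedAddCommGroup K] [InnerProductSpace ℂ K] [CompleteSpace K]
    (π : A →⋆ₐ[ℂ] (K →L[ℂ] K)) (hπ : Function.Injective π) (J : Hilb →ₗᵢ[ℂ] K)
    (B : StarSubalgebra ℂ A) (hB : TopologicalSpace.IsSeparable (B : Set A)) :
    ∃ (ρ : B →⋆ₐ[ℂ] Op) (J' : Hilb →ₗᵢ[ℂ] Hilb),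
      Function.Injective ρ ∧ (∀ b, IsCompactOperator (ρ b) → ρ b = 0) ∧
      ∀ (b : B) (v w : Hilb), π b (J v) = J w → ρ b (J' v) = J' w := by
  obtain ⟨L, _, _, _, σ, i, hσ, hsep⟩ := exists_amplification π
  obtain ⟨Z, hZc, hZB⟩ := exists_countable_separating π hπ hB
  have hHsep : TopologicalSpace.SeparableSpace Hilb := by
    let b : HilbertBasis ℕ ℂ Hilb := ⟨LinearIsometryEquiv.refl ℂ Hilb⟩
    have h1 := ((Set.countable_range b).isSeparable.span (R := ℂ)).closure
    rw [← Submodule.topologicalClosure_coe, b.dense_span, Submodule.top_coe] at h1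
    exact TopologicalSpace.isSeparable_univ_iff.1 h1
  obtain ⟨M, hMc, hMs, hMZ, hinv⟩ := exists_separable_invariant σ B hB
    (Z := Set.range (fun v => i 0 (J v)) ∪ ⋃ n, i n '' Z)
    ((TopologicalSpace.isSeparable_range ((i 0).continuous.comp J.continuous)).union
      (TopologicalSpace.IsSeparable.iUnion fun n => (hZc.image _).isSeparable))
  have := hMc.completeSpace_coe
  have := hMs.separableSpace
  let τ : B →⋆ₐ[ℂ] (M →L[ℂ] M) := subRep (σ.comp B.subtype) M fun b x hx => hinv b b.2 x hx
  have hτ : ∀ (b : B) (x : M), (τ b x : L) = σ (b : A) x := fun b x => rfl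
  have hess : ∀ b, IsCompactOperator (τ b) → b = 0 := by
    intro b hb
    by_contra hb0
    obtain ⟨ζ, hζ, hbζ⟩ := hZB b b.2 (fun h => hb0 (Subtype.ext h))
    let x : ℕ → M := fun n => ⟨i n ζ, hMZ (Or.inr (Set.mem_iUnion.2 ⟨n, ζ, hζ, rfl⟩))⟩
    have hx : ∀ n, x n ∈ Metric.closedBall (0 : M) ‖ζ‖ := by
      intro n
      rw [mem_closedBall_zero_iff]
      exact ((i n).norm_map ζ).le
    obtain ⟨Q, hQ, hQs⟩ := IsCompactOperator.image_closedBall_subset_compact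
      (f := (τ b).toLinearMap) hb ‖ζ‖
    obtain ⟨y, -, φ, hφ, hlim⟩ := hQ.tendsto_subseq (x := fun n => τ b (x n))
      (fun n => hQs ⟨x n, hx n, rfl⟩)
    have hpos : 0 < ‖π b ζ‖ := norm_pos_iff.2 hbζ
    obtain ⟨N, hN⟩ := Metric.cauchySeq_iff.1 hlim.cauchySeq _ hpos
    have h1 := hN N le_rfl (N + 1) (Nat.le_succ N)
    have hne : φ N ≠ φ (N + 1) := (hφ (Nat.lt_succ_self N)).ne
    have e : ∀ n, ((τ b (x n) : M) : L) = i n (π b ζ) := fun n => by rw [hτ, ← hσ]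
    have h2 : ‖π b ζ‖ ≤ dist (τ b (x (φ N))) (τ b (x (φ (N + 1)))) := by
      rw [Subtype.dist_eq, e, e, dist_eq_norm]
      exact hsep _ _ hne _
    exact absurd h1 (not_lt.2 h2)
  have hMfin : ¬ FiniteDimensional ℂ M := by
    intro h
    have : ProperSpace M := FiniteDimensional.proper ℂ M
    have h1 := hess 1 (by rw [map_one]; exact isCompactOperator_id)
    exact one_ne_zero h1
  obtain ⟨U⟩ := nonempty_linearIsometryEquiv_hilb M hMfin
  let J₀ : Hilb →ₗᵢ[ℂ] M :=
    { toLinearMap := ((i 0).toLinearMap.comp J.toLinearMap).codRestrict M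
        fun v => hMZ (Or.inl ⟨v, rfl⟩)
      norm_map' := fun v => ((i 0).norm_map _).trans (J.norm_map v) }
  let c : (M →L[ℂ] M) →⋆ₐ[ℂ] Op := (U.conjStarAlgEquiv : (M →L[ℂ] M) →⋆ₐ[ℂ] Op)
  have hc : ∀ (T : M →L[ℂ] M) (v : M), c T (U v) = U (T v) := by
    intro T v
    simp [c]
  refine ⟨c.comp τ, U.toLinearIsometry.comp J₀, ?_, ?_, ?_⟩
  · rw [injective_iff_map_eq_zero]
    intro b hb
    refine hess b ?_
    have : τ b = 0 := by
      ext1 v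
      apply U.injective
      rw [← hc]
      change (c.comp τ) b (U v) = _
      rw [hb]; simp
    rw [this]
    exact isCompactOperator_zero
  · intro b hb
    rw [hess b, map_zero]
    have e : (τ b : M → M) = fun v => U.symm ((c.comp τ) b (U v)) := by
      funext v
      change _ = U.symm (c (τ b) (U v))
      rw [hc]; simp
    rw [e]
    have h1 := hb.comp_clm (U : M →L[ℂ] Hilb)
    exact h1.clm_comp (U.symm : Hilb →L[ℂ] M)
  · intro b v w hvw
    change c (τ b) (U (J₀ v)) = U (J₀ w)
    rw [hc]
    congr 1
    apply Subtype.ext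
    change σ (b : A) (i 0 (J v)) = i 0 (J w)
    rw [hσ, hvw]

/-- A representation of `C⋆(F)` extends, on a larger space, to a faithful and essential
representation of `C⋆(G)` for `F ⊆ G`; the larger space is again `ℓ₂(ℕ)`, and `J` is the
embedding of the original one. Simplicity of the ambient algebra gives faithfulness. -/
theorem exists_essential_extension {A : Type*} [CStarAlgebra A] (hA : IsSimpleCStar A)
    {F G : Finset A} (hFG : F ⊆ G) (Φ : genCStar F →⋆ₐ[ℂ] Op) :
    ∃ (π : genCStar G →⋆ₐ[ℂ] Op) (J : Hilb →ₗᵢ[ℂ] Hilb),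
      Function.Injective π ∧ (∀ b, IsCompactOperator (π b) → π b = 0) ∧
      ∀ (a : A) (ha : a ∈ F) (v : Hilb),
        π ⟨a, mem_genCStar (hFG ha)⟩ (J v) = J (Φ ⟨a, mem_genCStar ha⟩ v) := by
  have := hA.1
  have hcl : IsClosed (genCStar F : Set A) := StarSubalgebra.isClosed_topologicalClosure _
  obtain ⟨K, _, _, _, σ, J, hσ⟩ := exists_extension (genCStar F) Φ
  have hinj : Function.Injective σ := by
    have hclosed : IsClosed (TwoSidedIdeal.ker σ : Set A) := by
      have e : (TwoSidedIdeal.ker σ : Set A) = σ ⁻¹' {0} := by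
        ext a; simp [TwoSidedIdeal.mem_ker]
      rw [e]
      exact isClosed_singleton.preimage (AddMonoidHomClass.continuous_of_bound σ 1 fun a => by
        rw [one_mul]; exact NonUnitalStarAlgHom.norm_apply_le σ a)
    rcases hA.2 _ hclosed with h | h
    · exact (TwoSidedIdeal.ker_eq_bot σ).1 h
    · exfalso
      have h1 : (1 : A) ∈ TwoSidedIdeal.ker σ := by rw [h]; trivial
      rw [TwoSidedIdeal.mem_ker, map_one] at h1
      have h2 : J (lp.single 2 0 1) = 0 := by
        have := congrArg (fun T : K →L[ℂ] K => T (J (lp.single 2 0 1))) h1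
        simpa using this
      have h3 : ‖J (lp.single 2 0 1)‖ = 1 := by
        rw [J.norm_map, lp.norm_single (by norm_num)]; simp
      rw [h2] at h3
      simp at h3
  obtain ⟨π, J', h1, h2, h3⟩ := exists_essential σ hinj J (genCStar G) (isSeparable_genCStar G)
  exact ⟨π, J', h1, h2, fun a ha v => h3 _ v _ (hσ ⟨a, mem_genCStar ha⟩ v)⟩

end Separable

/-! ### Unitaries with prescribed behaviour on finite-dimensional subspaces -/

section Unitaries

variable {E V : Type*} [NormedAddCommGroup E] [InnerProductSpace ℂ E]
  [NormedAddCommGroup V] [InnerProductSpace ℂ V]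

/-- Any two isometric embeddings into a finite-dimensional space are conjugate by a unitary. -/
theorem exists_unitary_comp_eq [FiniteDimensional ℂ V] (f g : E →ₗᵢ[ℂ] V) :
    ∃ U : V ≃ₗᵢ[ℂ] V, ∀ e, U (f e) = g e := by
  let L : LinearMap.range f.toLinearMap →ₗᵢ[ℂ] V :=
    g.comp f.equivRange.symm.toLinearIsometry
  refine ⟨L.extend.toLinearIsometryEquiv rfl, fun e => ?_⟩
  have h1 : L.extend ((f.equivRange e : LinearMap.range f.toLinearMap) : V) = g e := by
    rw [LinearIsometry.extend_apply]
    simp [L]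
  simpa using h1

/-- A unitary on a finite-dimensional subspace extends to the whole space, by the identity on the
orthogonal complement. -/
theorem exists_unitary_extension (S : Submodule ℂ V) [S.HasOrthogonalProjection]
    (U : S ≃ₗᵢ[ℂ] S) : ∃ W : V ≃ₗᵢ[ℂ] V, ∀ s : S, W s = U s := by
  let P : V →ₗ[ℂ] V := S.starProjection.toLinearMap
  let T : (S ≃ₗᵢ[ℂ] S) → V →ₗ[ℂ] V := fun U =>
    S.subtype ∘ₗ U.toLinearEquiv.toLinearMap ∘ₗ S.orthogonalProjectionOnto.toLinearMap +
      (LinearMap.id - P)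
  have hT : ∀ U v, T U v = (U (S.orthogonalProjectionOnto v) : V) + (v - S.starProjection v) :=
    fun U v => rfl
  have hTn : ∀ U v, ‖T U v‖ = ‖v‖ := by
    intro U v
    have h1 : ⟪(U (S.orthogonalProjectionOnto v) : V), v - S.starProjection v⟫_ℂ = 0 :=
      (Submodule.mem_orthogonal _ _).1 (S.sub_starProjection_mem_orthogonal v) _ (U _).2
    have h2 : ⟪S.starProjection v, v - S.starProjection v⟫_ℂ = 0 :=
      (Submodule.mem_orthogonal _ _).1 (S.sub_starProjection_mem_orthogonal v) _
        (S.starProjection_apply_mem v)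
    have h3 := norm_add_sq_eq_norm_sq_add_norm_sq_of_inner_eq_zero _ _ h1
    have h4 := norm_add_sq_eq_norm_sq_add_norm_sq_of_inner_eq_zero _ _ h2
    have h5 : ‖(U (S.orthogonalProjectionOnto v) : V)‖ = ‖S.starProjection v‖ :=
      U.norm_map _
    rw [add_sub_cancel] at h4
    rw [hT, ← sq_eq_sq₀ (norm_nonneg _) (norm_nonneg _), sq, sq, h3, h4, h5]
  have hTS : ∀ U (s : S), T U s = U s := by
    intro U s
    rw [hT, Submodule.starProjection_mem_subspace_eq_self]
    simp
  have hTT : ∀ U v, T U (T U.symm v) = v := by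
    intro U v
    conv_lhs => rw [hT U.symm, map_add, hTS]
    have e1 : S.starProjection (v - S.starProjection v) = 0 :=
      S.starProjection_apply_eq_zero_iff.2 (S.sub_starProjection_mem_orthogonal v)
    have e2 : S.orthogonalProjectionOnto (v - S.starProjection v) = 0 := Subtype.ext e1
    rw [LinearIsometryEquiv.apply_symm_apply, hT, e1, e2, map_zero, sub_zero, Submodule.coe_zero,
      zero_add]
    exact add_sub_cancel _ _
  let W : V ≃ₗᵢ[ℂ] V :=
    { toLinearEquiv := LinearEquiv.ofLinearMap (T U) (T U.symm)
        (LinearMap.ext (hTT U)) (LinearMap.ext (hTT U.symm))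
      norm_map' := hTn U }
  exact ⟨W, hTS U⟩

/-- There is room for a unitary that has prescribed values on a small subspace and maps a larger
subspace `Y` into a given subspace `Q` of sufficient dimension. -/
theorem exists_unitary_mapsTo (Y Q : Submodule ℂ V) [FiniteDimensional ℂ Y]
    [FiniteDimensional ℂ Q] (f g : E →ₗᵢ[ℂ] V) (hf : ∀ e, f e ∈ Y) (hg : ∀ e, g e ∈ Q)
    (hYQ : Module.finrank ℂ Y ≤ Module.finrank ℂ Q) :
    ∃ W : V ≃ₗᵢ[ℂ] V, (∀ e, W (f e) = g e) ∧ ∀ y ∈ Y, W y ∈ Q := by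
  let bY := stdOrthonormalBasis ℂ Y
  let bQ := stdOrthonormalBasis ℂ Q
  let i₀ : Y →ₗ[ℂ] Q := bY.toBasis.constr ℂ (fun k => bQ (Fin.castLE hYQ k))
  have hi₀ : i₀ ∘ bY.toBasis = fun k => bQ (Fin.castLE hYQ k) := by
    funext k
    simp [i₀]
  let i : Y →ₗᵢ[ℂ] Q := i₀.isometryOfOrthonormal (v := bY.toBasis)
    (by rw [OrthonormalBasis.coe_toBasis]; exact bY.orthonormal)
    (by rw [hi₀]; exact bQ.orthonormal.comp _ (Fin.castLE_injective hYQ))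
  let fY : E →ₗᵢ[ℂ] Y := ⟨f.toLinearMap.codRestrict Y hf, fun e => f.norm_map e⟩
  let gQ : E →ₗᵢ[ℂ] Q := ⟨g.toLinearMap.codRestrict Q hg, fun e => g.norm_map e⟩
  obtain ⟨U, hU⟩ := exists_unitary_comp_eq (i.comp fY) gQ
  let S : Submodule ℂ V := Y ⊔ Q
  let a : Y →ₗᵢ[ℂ] S := ⟨Submodule.inclusion le_sup_left, fun _ => rfl⟩
  let c : Q →ₗᵢ[ℂ] S := ⟨Submodule.inclusion le_sup_right, fun _ => rfl⟩
  obtain ⟨U', hU'⟩ := exists_unitary_comp_eq a (c.comp (U.toLinearIsometry.comp i))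
  obtain ⟨W, hW⟩ := exists_unitary_extension S U'
  have key : ∀ y : Y, W y = (U (i y) : V) := by
    intro y
    have h1 := hW (a y)
    rw [hU'] at h1
    exact h1
  refine ⟨W, fun e => ?_, fun y hy => ?_⟩
  · have h1 := key (fY e)
    have h2 := hU e
    replace h2 : U (i (fY e)) = gQ e := h2
    rw [h2] at h1
    exact h1
  · have := key ⟨y, hy⟩
    rw [this]
    exact (U _).2

end Unitaries

/-! ### Supports and fixed spaces of finite-rank contractions -/

section Supports

theorem isStarProjection_low (h : Op) : IsStarProjection (low h) :=
  isStarProjection_starProjection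

theorem isStarProjection_high (h : Op) : IsStarProjection (high h) :=
  isStarProjection_starProjection

theorem isStarProjection_joinProj (R h : Op) : IsStarProjection (joinProj R h) :=
  isStarProjection_starProjection

theorem mem_range_of_high_apply {h : Op} (hh : FiniteRank h) {ξ : Hilb} (hξ : high h ξ = ξ) :
    ξ ∈ LinearMap.range h.toLinearMap := by
  have h1 : ξ ∈ (LinearMap.range h.toLinearMap).topologicalClosure :=
    Submodule.starProjection_eq_self_iff.1 hξ
  have : FiniteDimensional ℂ (LinearMap.range h.toLinearMap) := hh
  rwa [(Submodule.closed_of_finiteDimensional _).submodule_topologicalClosure_eq] at h1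

theorem high_apply_of_mem_range {h : Op} {ξ : Hilb} (hξ : ξ ∈ LinearMap.range h.toLinearMap) :
    high h ξ = ξ := by
  obtain ⟨η, rfl⟩ := hξ
  exact high_apply h η

theorem mul_high_of_wayAbove {k h : Op} (hh : FiniteRank h) (hk : WayAbove k h) :
    k * high h = high h := by
  ext1 ξ
  obtain ⟨η, hη⟩ := mem_range_of_high_apply hh (ξ := high h ξ)
    (congrArg (fun T : Op => T ξ) (isStarProjection_high h).isIdempotentElem)
  change k (high h ξ) = high h ξ
  rw [← hη]
  exact congrArg (fun T : Op => T η) hk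

/-- The support of `h` is contained in the fixed space of every `k ≫ h`. -/
theorem low_mul_high_of_wayAbove {k h : Op} (hh : FiniteRank h) (hk : WayAbove k h) :
    low k * high h = high h := by
  ext1 ξ
  exact low_apply_of_fixed (congrArg (fun T : Op => T ξ) (mul_high_of_wayAbove hh hk))

theorem mul_eq_of_posContr_of_le {h R : Op} (hh : h ∈ posContr) (hR : IsStarProjection R)
    (hle : R ≤ h) : h * R = R := by
  have h1 : h ≤ 1 := (CStarAlgebra.norm_le_one_iff_of_nonneg h hh.2.1).1 hh.2.2
  have h2 := (IsStarProjection.mul_right_and_mul_left_of_nonneg_of_le (a := 1 - h) hR.one_sub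
    (sub_nonneg.2 h1) (sub_le_sub_left hle 1)).1
  have h3 : (1 - h) * (1 - R) = 1 - h - R + h * R := by noncomm_ring
  rw [h3] at h2
  have h4 : h * R - R = 0 := by
    have : 1 - h - R + h * R - (1 - h) = 0 := by rw [h2, sub_self]
    rw [← this]; abel
  exact sub_eq_zero.1 h4

/-- An operator that is the identity on the ranges of `R` and of `h⁺` is a left identity for the
corner `S_{R,h} B(H) h⁺`. -/
theorem mul_eq_of_mem_corner {P R h T : Op} (hPR : P * R = R) (hPh : P * high h = high h)
    (hT : T ∈ corner R h) : P * T = T := by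
  obtain ⟨X, rfl⟩ := hT
  have hle : (Submodule.span ℂ (Set.range (high h) ∪ Set.range R)).topologicalClosure ≤
      LinearMap.ker (P - 1).toLinearMap := by
    refine Submodule.topologicalClosure_minimal _ (Submodule.span_le.2 ?_)
      (ContinuousLinearMap.isClosed_ker (P - 1))
    rintro _ (⟨η, rfl⟩ | ⟨η, rfl⟩)
    · have := congrArg (fun T : Op => T η) hPh
      simpa [sub_eq_zero] using this
    · have := congrArg (fun T : Op => T η) hPR
      simpa [sub_eq_zero] using this
  ext1 ξ
  have h1 := hle (Submodule.starProjection_apply_mem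
    (Submodule.span ℂ (Set.range (high h) ∪ Set.range R)).topologicalClosure (X (high h ξ)))
  have h2 : P (joinProj R h (X (high h ξ))) - joinProj R h (X (high h ξ)) = 0 := h1
  exact sub_eq_zero.1 h2

theorem mul_high_of_mem_corner {R h T : Op} (hT : T ∈ corner R h) : T * high h = T := by
  obtain ⟨X, rfl⟩ := hT
  rw [mul_assoc, (isStarProjection_high h).isIdempotentElem]

theorem joinProj_mul_high (R h : Op) : joinProj R h * high h = high h := by
  ext1 ξ
  exact Submodule.starProjection_eq_self_iff.2 (Submodule.le_topologicalClosure _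
    (Submodule.subset_span (Or.inl ⟨ξ, rfl⟩)))

theorem joinProj_mul_left (R h : Op) : joinProj R h * R = R := by
  ext1 ξ
  exact Submodule.starProjection_eq_self_iff.2 (Submodule.le_topologicalClosure _
    (Submodule.subset_span (Or.inr ⟨ξ, rfl⟩)))

theorem mapsRange_iff {T P Q : Op} (hQ : Q * Q = Q) : MapsRange T P Q ↔ Q * (T * P) = T * P := by
  constructor
  · intro hT
    ext1 ξ
    obtain ⟨η, hη⟩ := hT ⟨ξ, rfl⟩
    change Q (T (P ξ)) = T (P ξ)
    rw [← hη]
    exact congrArg (fun T : Op => T η) hQ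
  · rintro h _ ⟨ξ, rfl⟩
    exact ⟨T (P ξ), congrArg (fun T : Op => T ξ) h⟩

end Supports

/-! ### Finding elements of the parameter set -/

section Parameters

open Filter Topology

/-- Strong convergence is uniform on finite-dimensional subspaces. -/
theorem eventually_norm_sub_le {P : ℕ → Op} (hP : ∀ ξ, Tendsto (fun n => P n ξ) atTop (𝓝 ξ))
    (Z : Submodule ℂ Hilb) [FiniteDimensional ℂ Z] {r : ℝ} (hr : 0 < r) :
    ∀ᶠ n in atTop, ∀ z ∈ Z, ‖z - P n z‖ ≤ r * ‖z‖ := by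
  let b := stdOrthonormalBasis ℂ Z
  have h1 : Tendsto (fun n => ∑ i, ‖(b i : Hilb) - P n (b i)‖) atTop (𝓝 0) := by
    have : Tendsto (fun n => ∑ i, ‖(b i : Hilb) - P n (b i)‖) atTop
        (𝓝 (∑ i, ‖(b i : Hilb) - b i‖)) :=
      tendsto_finsetSum _ fun i _ => (tendsto_const_nhds.sub (hP _)).norm
    simpa using this
  filter_upwards [h1.eventually_le_const hr] with n hn z hz
  have h2 : z = ∑ i, ⟪b i, (⟨z, hz⟩ : Z)⟫_ℂ • (b i : Hilb) := by
    have := congrArg (Submodule.subtype Z) (b.sum_repr' ⟨z, hz⟩)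
    simpa using this.symm
  have h3 : z - P n z = ∑ i, ⟪b i, (⟨z, hz⟩ : Z)⟫_ℂ • ((b i : Hilb) - P n (b i)) := by
    conv_lhs => rw [h2]
    rw [map_sum, ← Finset.sum_sub_distrib]
    exact Finset.sum_congr rfl fun i _ => by rw [map_smul, smul_sub]
  rw [h3]
  calc _ ≤ ∑ i, ‖⟪b i, (⟨z, hz⟩ : Z)⟫_ℂ • ((b i : Hilb) - P n (b i))‖ := norm_sum_le _ _
    _ ≤ ∑ i, ‖z‖ * ‖(b i : Hilb) - P n (b i)‖ := by
      refine Finset.sum_le_sum fun i _ => ?_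
      rw [norm_smul]
      refine mul_le_mul_of_nonneg_right ?_ (norm_nonneg _)
      refine (norm_inner_le_norm (𝕜 := ℂ) (b i) (⟨z, hz⟩ : Z)).trans ?_
      rw [b.orthonormal.1 i, one_mul]
      exact le_of_eq rfl
    _ = ‖z‖ * ∑ i, ‖(b i : Hilb) - P n (b i)‖ := by rw [Finset.mul_sum]
    _ ≤ ‖z‖ * r := mul_le_mul_of_nonneg_left hn (norm_nonneg _)
    _ = r * ‖z‖ := mul_comm _ _

theorem eventually_norm_one_sub_mul_le {P : ℕ → Op}
    (hP : ∀ ξ, Tendsto (fun n => P n ξ) atTop (𝓝 ξ)) {T : Op} (hT : FiniteRank T) {r : ℝ}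
    (hr : 0 < r) : ∀ᶠ n in atTop, ‖(1 - P n) * T‖ ≤ r := by
  have : FiniteDimensional ℂ (LinearMap.range T.toLinearMap) := hT
  filter_upwards [eventually_norm_sub_le hP (LinearMap.range T.toLinearMap)
    (r := r / (‖T‖ + 1)) (by positivity)] with n hn
  refine ContinuousLinearMap.opNorm_le_bound _ hr.le fun ξ => ?_
  refine (hn (T ξ) ⟨ξ, rfl⟩).trans ?_
  calc r / (‖T‖ + 1) * ‖T ξ‖ ≤ r / (‖T‖ + 1) * ((‖T‖ + 1) * ‖ξ‖) := by
        gcongr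
        exact (T.le_opNorm ξ).trans (by gcongr; linarith)
    _ = r * ‖ξ‖ := by field_simp

theorem eventually_finrank_le (X : Params) (Y : Submodule ℂ Hilb) [FiniteDimensional ℂ Y] :
    ∀ᶠ n in atTop,
      Module.finrank ℂ Y ≤ Module.finrank ℂ (LinearMap.range (X.proj n).toLinearMap) := by
  filter_upwards [eventually_norm_sub_le X.proj_tendsto Y (r := 1 / 2) (by norm_num)] with n hn
  have : FiniteDimensional ℂ (LinearMap.range (X.proj n).toLinearMap) := X.proj_finiteRank n
  let f : Y →ₗ[ℂ] LinearMap.range (X.proj n).toLinearMap :=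
    (X.proj n).toLinearMap.rangeRestrict ∘ₗ Y.subtype
  refine LinearMap.finrank_le_finrank_of_injective (f := f) ?_
  rw [injective_iff_map_eq_zero]
  intro y hy
  have h1 : X.proj n y = 0 := congrArg Subtype.val hy
  have h2 := hn y y.2
  rw [h1, sub_zero] at h2
  have h3 : ‖(y : Hilb)‖ = 0 := le_antisymm (by linarith) (norm_nonneg _)
  exact Subtype.ext (norm_eq_zero.1 h3)

theorem finiteRank_of_range_le {T : Op} {M : Submodule ℂ Hilb} [FiniteDimensional ℂ M]
    (h : ∀ ξ, T ξ ∈ M) : FiniteRank T :=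
  Submodule.finiteDimensional_of_le (S₂ := M) (by rintro _ ⟨ξ, rfl⟩; exact h ξ)

theorem FiniteRank.high {h : Op} (hh : FiniteRank h) : FiniteRank (high h) :=
  have : FiniteDimensional ℂ (LinearMap.range h.toLinearMap) := hh
  finiteRank_of_range_le (M := LinearMap.range h.toLinearMap) fun ξ =>
    mem_range_of_high_apply hh
      (congrArg (fun T : Op => T ξ) (isStarProjection_high h).isIdempotentElem)

theorem half_smul_nonneg {T : Op} (hT : 0 ≤ T) : 0 ≤ (1 / 2 : ℝ) • T := by
  rw [ContinuousLinearMap.nonneg_iff_isPositive] at hT ⊢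
  have := hT.smul_of_nonneg (c := ((1 / 2 : ℝ) : ℂ)) (Complex.zero_le_real.2 (by norm_num))
  rwa [Complex.coe_smul] at this

/-- The mean of the projections onto `N ≤ M` is a finite-rank positive contraction. (It fixes
exactly the vectors of `N`, and its range is `M`.) -/
theorem mean_mem_posContr {N M : Submodule ℂ Hilb} [FiniteDimensional ℂ N] [FiniteDimensional ℂ M]
    (hNM : N ≤ M) :
    (1 / 2 : ℝ) • M.starProjection + (1 / 2 : ℝ) • N.starProjection ∈ posContr := by
  refine ⟨finiteRank_of_range_le (M := M) fun ξ => ?_, ?_, ?_⟩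
  · have h1 : (1 / 2 : ℝ) • M.starProjection ξ ∈ M :=
      M.smul_of_tower_mem (1 / 2 : ℝ) (M.starProjection_apply_mem ξ)
    have h2 : (1 / 2 : ℝ) • N.starProjection ξ ∈ M :=
      M.smul_of_tower_mem (1 / 2 : ℝ) (hNM (N.starProjection_apply_mem ξ))
    exact M.add_mem h1 h2
  · exact add_nonneg
      (half_smul_nonneg isStarProjection_starProjection.nonneg)
      (half_smul_nonneg isStarProjection_starProjection.nonneg)
  · refine (norm_add_le _ _).trans ?_
    rw [norm_smul, norm_smul]
    have h1 := M.starProjection_norm_le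
    have h2 := N.starProjection_norm_le
    norm_num
    linarith

theorem starProjection_le_of {R : Op} (hR : IsStarProjection R) {N : Submodule ℂ Hilb}
    [FiniteDimensional ℂ N] (h : ∀ ξ, R ξ ∈ N) : R ≤ N.starProjection :=
  hR.le_of_mul_eq_right isStarProjection_starProjection (by
    ext1 ξ
    exact Submodule.starProjection_eq_self_iff.2 (h ξ))

/-- There is an element of `C` above any finite set of elements of `C` and any of the
projections. -/
theorem exists_mem_C_wayAbove (X : Params) (s : Finset Op) (hs : s.Nonempty)
    (hsC : (s : Set Op) ⊆ X.C) {R : Op} (hR : R ∈ Set.range X.proj) :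
    ∃ k ∈ X.C, (∀ c ∈ s, WayAbove k c) ∧ R ≤ k := by
  obtain ⟨m, rfl⟩ := hR
  let N : Submodule ℂ Hilb :=
    LinearMap.range (X.proj m).toLinearMap ⊔ ⨆ c : s, LinearMap.range (c : Op).toLinearMap
  have h1 : FiniteDimensional ℂ (LinearMap.range (X.proj m).toLinearMap) := X.proj_finiteRank m
  have h2 : ∀ c : s, FiniteDimensional ℂ (LinearMap.range (c : Op).toLinearMap) :=
    fun c => (X.C_subset (hsC c.2)).1
  have hN : FiniteDimensional ℂ N := inferInstance
  have hmem : N.starProjection ∈ posContr := by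
    have := mean_mem_posContr (le_refl N)
    rwa [← add_smul, add_halves, one_smul] at this
  have h3 := X.closure_C s hs hsC (X.proj m) ⟨m, rfl⟩ ⟨hmem, fun c hc => ?_, ?_⟩
  · obtain ⟨k, hkC, -, hk1, hk2⟩ := closure_nonempty_iff.1 ⟨_, h3⟩
    exact ⟨k, hkC, hk1, hk2⟩
  · ext1 ξ
    refine Submodule.starProjection_eq_self_iff.2 (Submodule.mem_sup_right ?_)
    exact Submodule.mem_iSup_of_mem (⟨c, hc⟩ : s) ⟨ξ, rfl⟩
  · exact starProjection_le_of (X.proj_isStarProjection m)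
      fun ξ => Submodule.mem_sup_left ⟨ξ, rfl⟩

/-- An element of `C` with prescribed fixed space `N = k[H] + R[H]` and a support that is at least
as large as a given finite-dimensional space `M ⊇ N`. It is found within `1 / 2` of the mean of the
projections onto `M` and `N`: there the requirements `h ≫ k` and `h ≥ R` force `h` to fix `N`, while
the distance prevents further fixed vectors and keeps `h` injective on `M`. -/
theorem exists_mem_C_fixed_eq (X : Params) {k : Op} (hk : k ∈ X.C) {R : Op}
    (hR : R ∈ Set.range X.proj) (M : Submodule ℂ Hilb) [FiniteDimensional ℂ M]
    (hNM : LinearMap.range k.toLinearMap ⊔ LinearMap.range R.toLinearMap ≤ M) :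
    ∃ h ∈ X.C, WayAbove h k ∧
      (∀ ξ, h ξ = ξ ↔ ξ ∈ LinearMap.range k.toLinearMap ⊔ LinearMap.range R.toLinearMap) ∧
      Module.finrank ℂ M ≤ Module.finrank ℂ (LinearMap.range h.toLinearMap) := by
  obtain ⟨m, rfl⟩ := hR
  set N := LinearMap.range k.toLinearMap ⊔ LinearMap.range (X.proj m).toLinearMap with hN
  have h1 : FiniteDimensional ℂ (LinearMap.range (X.proj m).toLinearMap) := X.proj_finiteRank m
  have h2 : FiniteDimensional ℂ (LinearMap.range k.toLinearMap) := (X.C_subset hk).1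
  have hNfd : FiniteDimensional ℂ N := inferInstance
  set h' : Op := (1 / 2 : ℝ) • M.starProjection + (1 / 2 : ℝ) • N.starProjection with hh'
  have happ : ∀ ξ, h' ξ = (1 / 2 : ℝ) • M.starProjection ξ + (1 / 2 : ℝ) • N.starProjection ξ :=
    fun ξ => rfl
  have hfix : ∀ ξ ∈ N, h' ξ = ξ := by
    intro ξ hξ
    rw [happ, Submodule.starProjection_eq_self_iff.2 hξ,
      Submodule.starProjection_eq_self_iff.2 (hNM hξ), ← add_smul, add_halves, one_smul]
  have hRle : X.proj m ≤ h' := by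
    have hle1 := starProjection_le_of (X.proj_isStarProjection m) (N := N)
      fun ξ => Submodule.mem_sup_right ⟨ξ, rfl⟩
    have hle2 : N.starProjection ≤ M.starProjection :=
      Submodule.starProjection_le_starProjection_iff.2 hNM
    have e : h' - N.starProjection = (1 / 2 : ℝ) • (M.starProjection - N.starProjection) := by
      rw [hh']; module
    refine hle1.trans (sub_nonneg.1 ?_)
    rw [e]
    exact half_smul_nonneg (sub_nonneg.2 hle2)
  have hcl := X.closure_C {k} (Finset.singleton_nonempty k) (by simpa using hk) (X.proj m) ⟨m, rfl⟩
    ⟨mean_mem_posContr hNM, fun c hc => by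
      rw [Finset.mem_singleton] at hc
      subst hc
      ext1 ξ
      exact hfix _ (Submodule.mem_sup_left ⟨ξ, rfl⟩), hRle⟩
  obtain ⟨h, ⟨hhC, hpos, hway, hRh⟩, hdist⟩ :=
    Metric.mem_closure_iff.1 hcl (1 / 2) (by norm_num)
  replace hway : WayAbove h k := hway k (Finset.mem_singleton_self k)
  rw [dist_comm, dist_eq_norm] at hdist
  have hlt : ∀ ξ, ξ ≠ 0 → ‖h ξ - h' ξ‖ < 1 / 2 * ‖ξ‖ := by
    intro ξ hξ
    refine ((h - h').le_opNorm ξ).trans_lt ?_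
    exact mul_lt_mul_of_pos_right hdist (norm_pos_iff.2 hξ)
  have hhN : ∀ ξ ∈ N, h ξ = ξ := by
    intro ξ hξ
    obtain ⟨_, ⟨a, rfl⟩, _, ⟨b, rfl⟩, rfl⟩ := Submodule.mem_sup.1 hξ
    have e1 : h (k a) = k a := congrArg (fun T : Op => T a) hway
    have e2 : h (X.proj m b) = X.proj m b := congrArg (fun T : Op => T b)
      (mul_eq_of_posContr_of_le hpos (X.proj_isStarProjection m) hRh)
    change h (k a + X.proj m b) = k a + X.proj m b
    rw [map_add, e1, e2]
  refine ⟨h, hhC, hway, fun ξ => ⟨fun hξ => ?_, hhN ξ⟩, ?_⟩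
  · by_contra hξN
    set ζ := ξ - N.starProjection ξ with hζ
    have hζ0 : ζ ≠ 0 := fun h0 => hξN
      (Submodule.starProjection_eq_self_iff.1 (sub_eq_zero.1 h0).symm)
    have hhζ : h ζ = ζ := by
      rw [hζ, map_sub, hξ, hhN _ (N.starProjection_apply_mem ξ)]
    have hNζ : N.starProjection ζ = 0 :=
      N.starProjection_apply_eq_zero_iff.2 (N.sub_starProjection_mem_orthogonal ξ)
    have h3 : ‖h' ζ‖ ≤ 1 / 2 * ‖ζ‖ := by
      rw [happ, hNζ, smul_zero, add_zero, norm_smul, Real.norm_of_nonneg (by norm_num)]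
      gcongr
      exact M.norm_starProjection_apply_le ζ
    have h4 := hlt ζ hζ0
    have h5 : ‖ζ‖ ≤ ‖h ζ - h' ζ‖ + ‖h' ζ‖ := by
      have := norm_add_le (h ζ - h' ζ) (h' ζ)
      rw [sub_add_cancel] at this
      rwa [hhζ] at this ⊢
    linarith
  · have : FiniteDimensional ℂ (LinearMap.range h.toLinearMap) := hpos.1
    let f : M →ₗ[ℂ] LinearMap.range h.toLinearMap := h.toLinearMap.rangeRestrict ∘ₗ M.subtype
    refine LinearMap.finrank_le_finrank_of_injective (f := f) ?_
    rw [injective_iff_map_eq_zero]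
    rintro ⟨ξ, hξM⟩ hξ
    replace hξ : h ξ = 0 := congrArg Subtype.val hξ
    by_contra hne
    have hξ0 : ξ ≠ 0 := fun h0 => hne (Subtype.ext h0)
    have h3 := hlt ξ hξ0
    rw [hξ, zero_sub, norm_neg] at h3
    -- the compression of the mean to `M` is bounded below by `1 / 2`
    have h4 : 1 / 2 * ‖ξ‖ ^ 2 ≤ RCLike.re ⟪h' ξ, ξ⟫_ℂ := by
      have e1 : RCLike.re ⟪h' ξ, ξ⟫_ℂ =
          1 / 2 * RCLike.re ⟪ξ, ξ⟫_ℂ + 1 / 2 * RCLike.re ⟪N.starProjection ξ, ξ⟫_ℂ := by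
        rw [happ, Submodule.starProjection_eq_self_iff.2 hξM, inner_add_left, map_add,
          ← smul_one_smul ℂ (1 / 2 : ℝ) ξ, ← smul_one_smul ℂ (1 / 2 : ℝ) (N.starProjection ξ),
          inner_smul_left, inner_smul_left]
        simp
      have e2 : 0 ≤ RCLike.re ⟪N.starProjection ξ, ξ⟫_ℂ := N.re_inner_starProjection_nonneg ξ
      rw [e1, inner_self_eq_norm_sq]
      linarith
    have h5 : RCLike.re ⟪h' ξ, ξ⟫_ℂ ≤ ‖h' ξ‖ * ‖ξ‖ := re_inner_le_norm _ _
    have h6 : 0 < ‖ξ‖ := norm_pos_iff.2 hξ0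
    nlinarith

end Parameters

/-! ### Adjusting a representation to the parameter set -/

section Adjust

open Filter

/-- Given an isometry `J`, finitely many operators `T` and `k ∈ C`, there are `h ∈ C` above `k` and
a unitary `W` inverting `J` on the fixed space of `k` such that the conjugates `W T W⁻¹` map the fixed
space of `k` into that of `h`, and the latter into the range of `h`. Only dimensions matter: the
fixed space of `h` is made large before `W` is chosen on the `T`-images of the fixed space of `k`,
and then the range of `h` is made large before `W` is corrected outside the fixed space of `h`. -/
theorem exists_unitary_adjusting (X : Params) {k : Op} (hk : k ∈ X.C) (J : Hilb →ₗᵢ[ℂ] Hilb)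
    (𝒯 : Finset Op) :
    ∃ h ∈ X.C, WayAbove h k ∧ ∃ W : Hilb ≃ₗᵢ[ℂ] Hilb,
      (∀ x, k x = x → W (J x) = x) ∧
      ∀ T ∈ 𝒯, (∀ x, k x = x → h (W (T (W.symm x))) = W (T (W.symm x))) ∧
        ∀ x, h x = x → W (T (W.symm x)) ∈ LinearMap.range h.toLinearMap := by
  have hkfd : FiniteDimensional ℂ (LinearMap.range k.toLinearMap) := (X.C_subset hk).1
  let V : Submodule ℂ Hilb := LinearMap.ker (k - 1).toLinearMap
  have hV : ∀ {x}, x ∈ V ↔ k x = x := by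
    intro x
    simp [V, sub_eq_zero]
  have hVk : V ≤ LinearMap.range k.toLinearMap := fun x hx => ⟨x, hV.1 hx⟩
  have hVfd : FiniteDimensional ℂ V := Submodule.finiteDimensional_of_le hVk
  let Y : Submodule ℂ Hilb := V.map J.toLinearMap ⊔
    ⨆ T : 𝒯, (V.map J.toLinearMap).map (T : Op).toLinearMap
  have hYfd : FiniteDimensional ℂ Y := inferInstance
  obtain ⟨m, hm⟩ := (eventually_finrank_le X Y).exists
  have hRfd : FiniteDimensional ℂ (LinearMap.range (X.proj m).toLinearMap) := X.proj_finiteRank m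
  let N : Submodule ℂ Hilb :=
    LinearMap.range k.toLinearMap ⊔ LinearMap.range (X.proj m).toLinearMap
  have hNfd : FiniteDimensional ℂ N := inferInstance
  obtain ⟨W₁, hW₁, hW₁Y⟩ := exists_unitary_mapsTo Y N (J.comp V.subtypeₗᵢ) V.subtypeₗᵢ
    (fun e => Submodule.mem_sup_left ⟨e, e.2, rfl⟩) (fun e => Submodule.mem_sup_left (hVk e.2))
    (hm.trans (Submodule.finrank_mono le_sup_right))
  have hW₁J : ∀ x, k x = x → W₁ (J x) = x := fun x hx => hW₁ ⟨x, hV.2 hx⟩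
  let c : Op → Op := fun T => (W₁ : Hilb →L[ℂ] Hilb) * T * (W₁.symm : Hilb →L[ℂ] Hilb)
  let M : Submodule ℂ Hilb := N ⊔ ⨆ T : 𝒯, N.map (c T).toLinearMap
  have hMfd : FiniteDimensional ℂ M := inferInstance
  obtain ⟨h, hhC, hhk, hhN, hhM⟩ :=
    exists_mem_C_fixed_eq X hk (R := X.proj m) ⟨m, rfl⟩ M le_sup_left
  have hhfd : FiniteDimensional ℂ (LinearMap.range h.toLinearMap) := (X.C_subset hhC).1
  obtain ⟨W₂, hW₂, hW₂M⟩ := exists_unitary_mapsTo M (LinearMap.range h.toLinearMap) N.subtypeₗᵢ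
    N.subtypeₗᵢ (fun e => Submodule.mem_sup_left e.2) (fun e => ⟨e, (hhN e).2 e.2⟩) hhM
  have hW₂N : ∀ x ∈ N, W₂ x = x := fun x hx => hW₂ ⟨x, hx⟩
  have hWJ : ∀ x, k x = x → (W₁.trans W₂) (J x) = x := by
    intro x hx
    rw [LinearIsometryEquiv.trans_apply, hW₁J x hx]
    exact hW₂N x (Submodule.mem_sup_left (hVk (hV.2 hx)))
  refine ⟨h, hhC, hhk, W₁.trans W₂, hWJ, fun T hT => ⟨fun x hx => ?_, fun x hx => ?_⟩⟩
  · have e : (W₁.trans W₂).symm x = J x := by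
      rw [LinearIsometryEquiv.symm_apply_eq, hWJ x hx]
    have h1 : T (J x) ∈ Y := Submodule.mem_sup_right (Submodule.mem_iSup_of_mem (⟨T, hT⟩ : 𝒯)
      ⟨J x, ⟨x, hV.2 hx, rfl⟩, rfl⟩)
    rw [e, LinearIsometryEquiv.trans_apply, hW₂N _ (hW₁Y _ h1)]
    exact (hhN _).2 (hW₁Y _ h1)
  · have hxN : x ∈ N := (hhN x).1 hx
    have e : (W₁.trans W₂).symm x = W₁.symm x := by
      rw [LinearIsometryEquiv.symm_apply_eq, LinearIsometryEquiv.trans_apply,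
        LinearIsometryEquiv.apply_symm_apply, hW₂N x hxN]
    rw [e, LinearIsometryEquiv.trans_apply]
    exact hW₂M _ (Submodule.mem_sup_right (Submodule.mem_iSup_of_mem (⟨T, hT⟩ : 𝒯)
      ⟨x, hxN, rfl⟩))

end Adjust

/-! ### Norm estimates for compressions -/

section Norms

/-- The difference of two comparable projections is a contraction. -/
theorem norm_sub_le_one {P Q : Op} (hP : IsStarProjection P) (hQ : IsStarProjection Q)
    (h : Q * P = P) : ‖Q - P‖ ≤ 1 :=
  ((hP.le_iff_sub hQ).1 (hP.le_of_mul_eq_right hQ h)).norm_le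

theorem norm_mul_le_of_norm_le_one {S T : Op} (hT : ‖T‖ ≤ 1) : ‖S * T‖ ≤ ‖S‖ :=
  (norm_mul_le S T).trans (mul_le_of_le_one_right (norm_nonneg _) hT)

theorem norm_mul_le_of_norm_le_one_left {S T : Op} (hS : ‖S‖ ≤ 1) : ‖S * T‖ ≤ ‖T‖ :=
  (norm_mul_le S T).trans (mul_le_of_le_one_left (norm_nonneg _) hS)

/-- An isometry preserves the norm of a finite-rank perturbation as long as it fixes the support
and the range of the perturbation: if `T` restricts to `T₀` along the isometry `V`, then the
perturbed `T` is the orthogonal sum of the perturbed `T₀` and of a compression of `T`. -/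
theorem norm_add_mul_one_sub_le (V : Hilb →ₗᵢ[ℂ] Hilb) {T T₀ B E : Op}
    (hT : ∀ ξ, T (V ξ) = V (T₀ ξ)) (hT' : ∀ ξ, star T (V ξ) = V (star T₀ ξ))
    (hEs : star E = E) (hE : ∀ ξ, V (E ξ) = E ξ) (hB : ∀ ξ, V (B ξ) = B ξ) (hBE : B * E = B) :
    ‖B + T * (1 - E)‖ ≤ max ‖B + T₀ * (1 - E)‖ ‖T‖ := by
  set v : Op := V.toContinuousLinearMap
  have hvv : star v * v = 1 := by
    rw [ContinuousLinearMap.star_eq_adjoint]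
    exact (ContinuousLinearMap.isometry_iff_adjoint_comp_self v).1 V.isometry
  have hTv : T * v = v * T₀ := by ext1 ξ; exact hT ξ
  have hTv' : star T * v = v * star T₀ := by ext1 ξ; exact hT' ξ
  have hvE : v * E = E := by ext1 ξ; exact hE ξ
  have hvB : v * B = B := by ext1 ξ; exact hB ξ
  have hEv : E * star v = E := by
    have := congrArg star hvE
    rwa [star_mul, hEs] at this
  have hBv : B * star v = B := by rw [← hBE, mul_assoc, hEv]
  have hvT : star v * T = T₀ * star v := by
    have := congrArg star hTv'
    rwa [star_mul, star_mul, star_star, star_star] at this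
  have hTE : T * E = v * (T₀ * E) := by
    conv_lhs => rw [← hvE]
    rw [← mul_assoc, hTv, mul_assoc]
  have hdec : B + T * (1 - E) = v * (B + T₀ * (1 - E)) * star v + T * (1 - v * star v) := by
    have e1 : v * B * star v = B := by rw [hvB, hBv]
    have e2 : v * (T₀ * E) * star v = T * E := by
      rw [← hTE, mul_assoc, hEv]
    have e3 : T * (v * star v) = v * T₀ * star v := by rw [← mul_assoc, hTv]
    have : v * (B + T₀ * (1 - E)) * star v + T * (1 - v * star v) =
        v * B * star v + v * T₀ * star v - v * (T₀ * E) * star v + T - T * (v * star v) := by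
      noncomm_ring
    rw [this, e1, e2, e3]
    noncomm_ring
  set c := max ‖B + T₀ * (1 - E)‖ ‖T‖
  have hc0 : 0 ≤ c := (norm_nonneg _).trans (le_max_right _ _)
  refine ContinuousLinearMap.opNorm_le_bound _ hc0 fun ζ => ?_
  set x : Hilb := star v ζ with hx
  set y : Hilb := ζ - v x with hy
  have hvy : star v y = 0 := by
    have := congrArg (fun S : Op => S x) hvv
    rw [hy, map_sub, ← hx]
    exact sub_eq_zero.2 this.symm
  have horth : ∀ z w, star v w = 0 → ⟪v z, w⟫_ℂ = 0 := by
    intro z w hw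
    rw [← ContinuousLinearMap.adjoint_inner_right, ← ContinuousLinearMap.star_eq_adjoint, hw,
      inner_zero_right]
  have happ : (B + T * (1 - E)) ζ = v ((B + T₀ * (1 - E)) x) + T y := by
    rw [hdec]; rfl
  have hTy : star v (T y) = 0 := by
    have := congrArg (fun S : Op => S y) hvT
    change star v (T y) = T₀ (star v y) at this
    rw [this, hvy, map_zero]
  have n1 := norm_add_sq_eq_norm_sq_add_norm_sq_of_inner_eq_zero _ _
    (horth ((B + T₀ * (1 - E)) x) _ hTy)
  have n2 := norm_add_sq_eq_norm_sq_add_norm_sq_of_inner_eq_zero _ _ (horth x y hvy)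
  have e4 : v x + y = ζ := by rw [hy]; abel
  have hvn : ∀ z, ‖v z‖ = ‖z‖ := V.norm_map
  rw [e4, hvn] at n2
  rw [hvn] at n1
  have b1 : ‖(B + T₀ * (1 - E)) x‖ ≤ c * ‖x‖ :=
    (ContinuousLinearMap.le_opNorm _ _).trans (by gcongr; exact le_max_left _ _)
  have b2 : ‖T y‖ ≤ c * ‖y‖ :=
    (ContinuousLinearMap.le_opNorm _ _).trans (by gcongr; exact le_max_right _ _)
  rw [happ]
  have b3 : ‖(B + T₀ * (1 - E)) x‖ * ‖(B + T₀ * (1 - E)) x‖ ≤ (c * ‖x‖) * (c * ‖x‖) := by gcongr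
  have b4 : ‖T y‖ * ‖T y‖ ≤ (c * ‖y‖) * (c * ‖y‖) := by gcongr
  refine le_of_sq_le_sq ?_ (by positivity)
  calc _ = ‖v ((B + T₀ * (1 - E)) x) + T y‖ * ‖v ((B + T₀ * (1 - E)) x) + T y‖ := sq _
    _ ≤ (c * ‖x‖) * (c * ‖x‖) + (c * ‖y‖) * (c * ‖y‖) := by rw [n1]; linarith
    _ = c ^ 2 * (‖x‖ * ‖x‖ + ‖y‖ * ‖y‖) := by ring
    _ = (c * ‖ζ‖) ^ 2 := by rw [← n2]; ring

end Norms

/-! ### Extending one operator -/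

section ExtendOperator

theorem mul_eq_left_of_mul_eq_right {P Q : Op} (hP : IsStarProjection P) (hQ : IsStarProjection Q)
    (h : Q * P = P) : P * Q = P := by
  have := congrArg star h
  rwa [star_mul, hP.isSelfAdjoint.star_eq, hQ.isSelfAdjoint.star_eq] at this

theorem mul_eq_of_mul_eq_of_mul_eq {P Q S : Op} (h₁ : Q * P = P) (h₂ : S * Q = Q) : S * P = P := by
  rw [← h₁, ← mul_assoc, h₂]

/-- If `x` maps the range of the projection `P` into that of `Q`, then
`P x⋆ = P x⋆ Q`. -/
theorem mul_mul_of_star {x P Q : Op} (hP : IsStarProjection P) (hQ : IsStarProjection Q)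
    (h : Q * (star x * P) = star x * P) : P * (x * Q) = P * x := by
  have := congrArg star h
  rwa [star_mul, star_mul, star_star, hP.isSelfAdjoint.star_eq, hQ.isSelfAdjoint.star_eq,
    mul_assoc] at this

theorem norm_sub_mul_le_add {ψ T x P : Op} {r s : ℝ} (hP : ‖P‖ ≤ 1) (h : ‖T - ψ‖ ≤ r)
    (h' : ‖(T - x) * P‖ ≤ s) : ‖(ψ - x) * P‖ ≤ s + r := by
  have e : (ψ - x) * P = (T - x) * P - (T - ψ) * P := by noncomm_ring
  rw [e]
  refine (norm_sub_le _ _).trans (add_le_add h' ?_)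
  exact (norm_mul_le_of_norm_le_one hP).trans h

/-- The defect of `S_{R,h}` is controlled by that of `R`. -/
theorem norm_joinProj_sub_one_mul_le {R h T : Op} {r : ℝ} (hT : ‖(1 - R) * T‖ ≤ r) :
    ‖(joinProj R h - 1) * T‖ ≤ r := by
  have e : (joinProj R h - 1) * T = (joinProj R h - 1) * ((1 - R) * T) := by
    have : (joinProj R h - 1) * ((1 - R) * T) =
      (joinProj R h - 1) * T - (joinProj R h * R) * T + R * T := by noncomm_ring
    rw [this, joinProj_mul_left]; abel
  rw [e]
  refine (norm_mul_le_of_norm_le_one_left ?_).trans hT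
  rw [norm_sub_rev]
  exact (isStarProjection_joinProj R h).one_sub.norm_le

variable {X : Params} {R h k x : Op}

/-- An element of `D R h` approximating the compression `S x h⁺` of a given operator. -/
theorem exists_mem_D_of_new (hR : R ∈ Set.range X.proj) (hh : h ∈ X.C) (hk : k ∈ X.C)
    (hhk : WayAbove h k) (hx₁ : MapsRange x (low k) (low h)) (hx₂ : MapsRange x (low h) (high h))
    {η : ℝ} (hη : 0 < η) (hxR : ‖(1 - R) * (x * high h)‖ ≤ η) :
    ∃ ψ ∈ X.D R h, MapsRange ψ (low k) (low h) ∧ MapsRange ψ (low h) (high h) ∧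
      ‖(ψ - x) * (high h - low k)‖ ≤ 2 * η ∧ ‖ψ + x * (1 - high h)‖ ≤ ‖x‖ + 2 * η := by
  have pκ := isStarProjection_low k
  have pf0 := isStarProjection_low h
  have pf := isStarProjection_high h
  rw [mapsRange_iff pf0.isIdempotentElem] at hx₁
  rw [mapsRange_iff pf.isIdempotentElem] at hx₂
  have r1 : low h * low k = low k := low_mul_low hhk
  have r2 : high h * low h = low h := high_mul_low h
  have r3 : joinProj R h * high h = high h := joinProj_mul_high R h
  have hxS := norm_joinProj_sub_one_mul_le (h := h) hxR
  set κ := low k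
  set f0 := low h
  set f := high h
  set S := joinProj R h
  have r4 : f * κ = κ := mul_eq_of_mul_eq_of_mul_eq r1 r2
  have r5 : S * f0 = f0 := mul_eq_of_mul_eq_of_mul_eq r2 r3
  have ff : f * f = f := pf.isIdempotentElem
  set T := S * (x * f) with hT
  have tκ : T * κ = x * κ := by
    rw [hT, mul_assoc, mul_assoc, r4, ← hx₁, ← mul_assoc, r5]
  have tf0 : T * f0 = x * f0 := by
    rw [hT, mul_assoc, mul_assoc, r2, ← hx₂, ← mul_assoc, r3]
  have hmem := X.closure_D R hR h hh k hk (a := T)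
    ⟨⟨x, by rw [hT, mul_assoc]⟩, (mapsRange_iff pf0.isIdempotentElem).2 (by rw [tκ, hx₁]),
      (mapsRange_iff pf.isIdempotentElem).2 (by rw [tf0, hx₂])⟩
  obtain ⟨ψ, ⟨hψD, -, hψ1, hψ2⟩, hψ⟩ := Metric.mem_closure_iff.1 hmem η hη
  rw [dist_eq_norm] at hψ
  have n1 : ‖f - κ‖ ≤ 1 := norm_sub_le_one pκ pf r4
  refine ⟨ψ, hψD, hψ1, hψ2, ?_, ?_⟩
  · rw [two_mul]
    refine norm_sub_mul_le_add n1 hψ.le ?_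
    have e : (T - x) * (f - κ) = (S - 1) * (x * f) * (f - κ) := by
      simp only [hT, mul_sub, sub_mul, mul_assoc, one_mul, ff, r4]
    rw [e]
    exact (norm_mul_le_of_norm_le_one n1).trans hxS
  · have e : ψ + x * (1 - f) = x + (S - 1) * (x * f) - (T - ψ) := by
      rw [hT]; noncomm_ring
    rw [e]
    linarith [norm_sub_le (x + (S - 1) * (x * f)) (T - ψ), norm_add_le x ((S - 1) * (x * f))]

/-- An element of `D R h` extending a given `b ∈ D R' h'` and approximating
`b + S x (h⁺ - h'⁺)`. -/
theorem exists_mem_D_of_old {R' h' b kq : Op} (hR : R ∈ Set.range X.proj) (hh : h ∈ X.C)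
    (hk : k ∈ X.C) (hR' : R' ∈ Set.range X.proj) (hh' : h' ∈ X.C) (hb : b ∈ X.D R' h')
    (hhk : WayAbove h k) (hkh : WayAbove k h') (hkR : low k * R' = R')
    (hkq : IsStarProjection kq) (hkq' : low h' * kq = kq)
    (hx₁ : MapsRange x (low k) (low h)) (hx₂ : MapsRange x (low h) (high h))
    (hx₃ : MapsRange (star x) (low h) (high h)) (hx₄ : MapsRange x kq (low h'))
    (hx₅ : MapsRange (star x) (low h') (high h')) (hb₁ : MapsRange b kq (low h'))
    {η : ℝ} (hη : 0 < η) (hxR : ‖(1 - R) * (x * high h)‖ ≤ η) :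
    ∃ ψ ∈ X.D R h, ψ * high h' = b ∧ low h' * ψ = low h' * b ∧
      MapsRange ψ (low k) (low h) ∧ MapsRange ψ (low h) (high h) ∧
      ‖(ψ - x) * (high h - low k)‖ ≤ 2 * η ∧
      ‖ψ + x * (1 - high h)‖ ≤ ‖b + x * (1 - high h')‖ + 2 * η ∧
      ‖(ψ - x) * (high h - kq)‖ ≤ ‖(b - x) * (high h' - kq)‖ + 2 * η ∧
      ‖(low h - low h') * (ψ - x)‖ ≤ ‖(b - x) * (high h' - kq)‖ + 2 * η := by
  have pκ := isStarProjection_low k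
  have pf0 := isStarProjection_low h
  have pf := isStarProjection_high h
  have pe0 := isStarProjection_low h'
  have pe := isStarProjection_high h'
  have pS := isStarProjection_joinProj R h
  rw [mapsRange_iff pf0.isIdempotentElem] at hx₁
  rw [mapsRange_iff pf.isIdempotentElem] at hx₂ hx₃
  rw [mapsRange_iff pe0.isIdempotentElem] at hx₄ hb₁
  rw [mapsRange_iff pe.isIdempotentElem] at hx₅
  have hbc : b ∈ corner R' h' := X.D_subset R' hR' h' hh' hb
  have r1 : low h * low k = low k := low_mul_low hhk
  have r2 : high h * low h = low h := high_mul_low h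
  have r3 : joinProj R h * high h = high h := joinProj_mul_high R h
  have r0 : high h' * low h' = low h' := high_mul_low h'
  have r0' : low k * high h' = high h' :=
    low_mul_high_of_wayAbove (X.C_subset hh').1 hkh
  have be : b * high h' = b := mul_high_of_mem_corner hbc
  have κb : low k * b = b := mul_eq_of_mem_corner hkR r0' hbc
  have hxS := norm_joinProj_sub_one_mul_le (h := h) hxR
  have hdens := X.closure_D_extend R hR R' hR' h hh h' hh' k hk b hb
  have hcorner : ∀ T, T = joinProj R h * T * high h → T ∈ corner R h := fun T hT => ⟨T, hT⟩
  have hd0 : ‖low h - low h'‖ ≤ 1 := norm_sub_le_one pe0 pf0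
    (low_mul_low (by unfold WayAbove at *; rw [← hkh, ← mul_assoc, hhk]))
  set κ := low k
  set f0 := low h
  set f := high h
  set e0 := low h'
  set e := high h'
  set S := joinProj R h
  -- all products of two of the projections `kq ≤ e0 ≤ e ≤ κ ≤ f0 ≤ f ≤ S`
  have ff : f * f = f := pf.isIdempotentElem
  have ee : e * e = e := pe.isIdempotentElem
  have SS : S * S = S := pS.isIdempotentElem
  have fκ : f * κ = κ := mul_eq_of_mul_eq_of_mul_eq r1 r2
  have f0e : f0 * e = e := mul_eq_of_mul_eq_of_mul_eq r0' r1
  have fe : f * e = e := mul_eq_of_mul_eq_of_mul_eq f0e r2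
  have ekq : e * kq = kq := mul_eq_of_mul_eq_of_mul_eq hkq' r0
  have fkq : f * kq = kq := mul_eq_of_mul_eq_of_mul_eq ekq fe
  have Sf0 : S * f0 = f0 := mul_eq_of_mul_eq_of_mul_eq r2 r3
  have Se : S * e = e := mul_eq_of_mul_eq_of_mul_eq f0e Sf0
  have Se0 : S * e0 = e0 := mul_eq_of_mul_eq_of_mul_eq r0 Se
  have f0e0 : f0 * e0 = e0 := mul_eq_of_mul_eq_of_mul_eq r0 f0e
  have e0S : e0 * S = e0 := mul_eq_left_of_mul_eq_right pe0 pS Se0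
  have f0S : f0 * S = f0 := mul_eq_left_of_mul_eq_right pf0 pS Sf0
  have ef : e * f = e := mul_eq_left_of_mul_eq_right pe pf fe
  have ef0 : e * f0 = e := mul_eq_left_of_mul_eq_right pe pf0 f0e
  have eκ : e * κ = e := mul_eq_left_of_mul_eq_right pe pκ r0'
  have bf : b * f = b := by rw [← be, mul_assoc, ef]
  have bf0 : b * f0 = b := by rw [← be, mul_assoc, ef0]
  have bκ : b * κ = b := by rw [← be, mul_assoc, eκ]
  have f0b : f0 * b = b := by rw [← κb, ← mul_assoc, r1]
  have fb : f * b = b := by rw [← κb, ← mul_assoc, fκ]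
  have Sb : S * b = b := by rw [← f0b, ← mul_assoc, Sf0]
  have xκe : x * e = x * κ * e := by rw [mul_assoc, r0']
  have Sxκ : S * (x * κ) = x * κ := by rw [← hx₁, ← mul_assoc, Sf0]
  have Sxf0 : S * (x * f0) = x * f0 := by rw [← hx₂, ← mul_assoc, r3]
  have Sxe : S * (x * e) = x * e := by rw [xκe, ← mul_assoc, Sxκ]
  have f0xe : f0 * (x * e) = x * e := by rw [xκe, ← mul_assoc, hx₁]
  have fxe : f * (x * e) = x * e := by rw [← f0xe, ← mul_assoc, r2]
  have f0xf : f0 * (x * f) = f0 * x := mul_mul_of_star pf0 pf hx₃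
  have e0xe : e0 * (x * e) = e0 * x := mul_mul_of_star pe0 pe hx₅
  have e0xf : e0 * (x * f) = e0 * x := by
    have : e0 * (x * f) = e0 * x * f := by noncomm_ring
    rw [this, ← e0xe, mul_assoc, mul_assoc, ef]
  have Exkq : (f0 - e0) * (x * kq) = 0 := by
    rw [← hx₄, ← mul_assoc, sub_mul, f0e0, pe0.isIdempotentElem, sub_self, zero_mul]
  have Ebkq : (f0 - e0) * (b * kq) = 0 := by
    rw [← hb₁, ← mul_assoc, sub_mul, f0e0, pe0.isIdempotentElem, sub_self, zero_mul]
  set T := b + S * (x * (f - e)) with hT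
  have hT' : T = b + S * (x * f) - x * e := by
    rw [hT, mul_sub, mul_sub, Sxe]; abel
  have Tκ : T * κ = b + x * κ - x * e := by
    simp only [hT', add_mul, sub_mul, mul_assoc, bκ, fκ, eκ, Sxκ]
  have Tf0 : T * f0 = b + x * f0 - x * e := by
    simp only [hT', add_mul, sub_mul, mul_assoc, bf0, r2, ef0, Sxf0]
  have hmem := hdens (a := T) ⟨hcorner T ?_, ?_, ?_, ?_, ?_⟩
  · obtain ⟨ψ, ⟨hψD, -, hψe, hψe0, hψ1, hψ2⟩, hψ⟩ := Metric.mem_closure_iff.1 hmem η hη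
    rw [dist_eq_norm] at hψ
    have n1 : ‖f - κ‖ ≤ 1 := norm_sub_le_one pκ pf fκ
    have n2 : ‖f - e‖ ≤ 1 := norm_sub_le_one pe pf fe
    have n3 : ‖f - kq‖ ≤ 1 := norm_sub_le_one hkq pf fkq
    have hxSe : ‖(S - 1) * (x * f) * (f - e)‖ ≤ η :=
      (norm_mul_le_of_norm_le_one n2).trans hxS
    refine ⟨ψ, hψD, hψe, hψe0, hψ1, hψ2, ?_, ?_, ?_, ?_⟩
    · rw [two_mul]
      refine norm_sub_mul_le_add n1 hψ.le ?_
      have e1 : (T - x) * (f - κ) = (S - 1) * (x * f) * (f - κ) := by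
        simp only [hT', mul_sub, sub_mul, add_mul, mul_assoc, one_mul, ff, fκ, bf, bκ, ef, eκ]
        abel
      rw [e1]
      exact (norm_mul_le_of_norm_le_one n1).trans hxS
    · have e1 : ψ + x * (1 - f) = (b + x * (1 - e)) + (S - 1) * (x * f) * (f - e) - (T - ψ) := by
        simp only [hT', mul_sub, sub_mul, mul_assoc, one_mul, mul_one, ff, fe, Sxe]
        abel
      rw [e1]
      linarith [norm_sub_le ((b + x * (1 - e)) + (S - 1) * (x * f) * (f - e)) (T - ψ),
        norm_add_le (b + x * (1 - e)) ((S - 1) * (x * f) * (f - e))]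
    · rw [two_mul, ← add_assoc]
      refine norm_sub_mul_le_add n3 hψ.le ?_
      have e1 : (T - x) * (f - kq) = (b - x) * (e - kq) + (S - 1) * (x * f) * (f - e) := by
        have hSxkq : S * (x * kq) = x * kq := by rw [← hx₄, ← mul_assoc, Se0]
        simp only [hT', mul_sub, sub_mul, add_mul, mul_assoc, one_mul, ff, fe, fkq, bf, be, ef, ekq,
          Sxe, hSxkq]
        abel
      rw [e1]
      exact (norm_add_le _ _).trans (add_le_add le_rfl hxSe)
    · have e1 : (f0 - e0) * (T - x) = (f0 - e0) * ((b - x) * (e - kq)) := by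
        have : (f0 - e0) * ((b - x) * (e - kq)) = (f0 - e0) * (b * e) - (f0 - e0) * (x * e) -
            (f0 - e0) * (b * kq) + (f0 - e0) * (x * kq) := by noncomm_ring
        rw [this, Exkq, Ebkq, be]
        have h1 : (f0 - e0) * (S * (x * f)) = (f0 - e0) * x := by
          rw [← mul_assoc, sub_mul f0 e0 S, f0S, e0S, sub_mul, sub_mul, f0xf, e0xf]
        rw [mul_sub, hT', mul_sub, mul_add, h1]
        abel
      have e2 : (f0 - e0) * (ψ - x) = (f0 - e0) * ((b - x) * (e - kq)) -
          (f0 - e0) * (T - ψ) := by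
        rw [← e1]; noncomm_ring
      rw [e2]
      have h1 : ‖(f0 - e0) * ((b - x) * (e - kq))‖ ≤ ‖(b - x) * (e - kq)‖ :=
        norm_mul_le_of_norm_le_one_left hd0
      have h2 : ‖(f0 - e0) * (T - ψ)‖ ≤ ‖T - ψ‖ := norm_mul_le_of_norm_le_one_left hd0
      linarith [norm_sub_le ((f0 - e0) * ((b - x) * (e - kq))) ((f0 - e0) * (T - ψ))]
  · simp only [hT', mul_add, mul_sub, add_mul, sub_mul, mul_assoc, bf, Sb, ff, ef, Sxe]
    rw [← mul_assoc S S, SS]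
  · simp only [hT', add_mul, sub_mul, mul_assoc, be, fe, ee, Sxe]
    abel
  · rw [hT', mul_sub, mul_add, ← mul_assoc e0 S, e0S, e0xf, e0xe]
    abel
  · rw [mapsRange_iff pf0.isIdempotentElem, Tκ, mul_sub, mul_add, f0b, hx₁, f0xe]
  · rw [mapsRange_iff pf.isIdempotentElem, Tf0, mul_sub, mul_add, fb, hx₂, fxe]

end ExtendOperator

/-! ### Conditions -/

section Conditions

open Filter Topology

variable {A : Type*} [CStarAlgebra A]

theorem bddAbove_normBound (F : Finset A) (ψ : A → Op) :
    BddAbove ((fun a => 3 * ‖a‖) '' (F : Set A) ∪ (fun a => 3 * ‖ψ a‖) '' (F : Set A) ∪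
      {coeffBound F}) :=
  (((F.finite_toSet.image _).union (F.finite_toSet.image _)).union
    (Set.finite_singleton _)).bddAbove

theorem three_mul_norm_le_normBound {F : Finset A} (ψ : A → Op) {a : A} (ha : a ∈ F) :
    3 * ‖a‖ ≤ normBound F ψ :=
  le_csSup (bddAbove_normBound F ψ) (Or.inl (Or.inl ⟨a, ha, rfl⟩))

theorem coeffBound_le_normBound (F : Finset A) (ψ : A → Op) : coeffBound F ≤ normBound F ψ :=
  le_csSup (bddAbove_normBound F ψ) (Or.inr rfl)

theorem normBound_le {F : Finset A} {ψ : A → Op} {c : ℝ} (h₁ : ∀ a ∈ F, 3 * ‖a‖ ≤ c)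
    (h₂ : ∀ a ∈ F, 3 * ‖ψ a‖ ≤ c) (h₃ : coeffBound F ≤ c) : normBound F ψ ≤ c := by
  refine csSup_le ⟨_, Or.inr rfl⟩ ?_
  rintro _ ((⟨a, ha, rfl⟩ | ⟨a, ha, rfl⟩) | rfl)
  · exact h₁ a ha
  · exact h₂ a ha
  · exact h₃

/-- Any promise of a condition can be transported to a representation of a larger algebra `C⋆(G)`
that is adapted to some `h ∈ C` above a given `k ∈ C`, with the same relation to the old
condition. -/
theorem exists_adapted_rep (hA : IsSimpleCStar A) {X : Params} (q : Condition X A) {kq : Op}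
    {Φ : genCStar q.F →⋆ₐ[ℂ] Op} (hP : IsPromise X q.F q.ε q.h q.ψ kq Φ) {G : Finset A}
    (hG : q.F ⊆ G) {k : Op} (hk : k ∈ X.C) (hkq : WayAbove k q.h) (hkR : k * q.R = q.R) :
    ∃ h ∈ X.C, WayAbove h k ∧ ∃ π : genCStar G →⋆ₐ[ℂ] Op, Function.Injective π ∧
      (∀ b, IsCompactOperator (π b) → π b = 0) ∧
      (∀ (a : A) (ha : a ∈ G), MapsRange (π ⟨a, mem_genCStar ha⟩) (low k) (low h) ∧
        MapsRange (π ⟨a, mem_genCStar ha⟩) (low h) (high h)) ∧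
      ∀ (a : A) (ha : a ∈ q.F),
        ‖(q.ψ a - π ⟨a, mem_genCStar (hG ha)⟩) * (high q.h - kq)‖ <
          (q.ε : ℝ) / (3 * normBound q.F q.ψ) ∧
        ‖q.ψ a + π ⟨a, mem_genCStar (hG ha)⟩ * (1 - high q.h)‖ < 3 / 2 * ‖a‖ ∧
        MapsRange (π ⟨a, mem_genCStar (hG ha)⟩) kq (low q.h) ∧
        MapsRange (π ⟨a, mem_genCStar (hG ha)⟩) (low q.h) (high q.h) := by
  classical
  obtain ⟨ρ, J, hρi, hρe, hρJ⟩ := exists_essential_extension hA hG Φ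
  obtain ⟨h, hhC, hhk, W, hWJ, hW⟩ := exists_unitary_adjusting X hk J
    (G.attach.image fun a : {y // y ∈ G} => ρ ⟨a, mem_genCStar a.2⟩)
  let c : Op →⋆ₐ[ℂ] Op := (W.conjStarAlgEquiv : Op →⋆ₐ[ℂ] Op)
  let V : Hilb →ₗᵢ[ℂ] Hilb := W.toLinearIsometry.comp J
  have hV : ∀ x, k x = x → V x = x := hWJ
  have hVΦ : ∀ (a : A) (ha : a ∈ q.F) (x : Hilb),
      (c.comp ρ) ⟨a, mem_genCStar (hG ha)⟩ (V x) = V (Φ ⟨a, mem_genCStar ha⟩ x) := by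
    intro a ha x
    change W (ρ ⟨a, mem_genCStar (hG ha)⟩ (W.symm (W (J x)))) = W (J _)
    rw [W.symm_apply_apply, hρJ a ha]
  have hclG : IsClosed (genCStar G : Set A) := StarSubalgebra.isClosed_topologicalClosure _
  have hkhigh : k * high q.h = high q.h := mul_high_of_wayAbove (X.C_subset q.h_mem).1 hkq
  have hlowkq : low q.h * kq = kq :=
    (hP.isStarProjection.le_iff_mul_eq_right (isStarProjection_low _)).1 hP.le_low
  have hVhigh : ∀ ξ, V (high q.h ξ) = high q.h ξ := fun ξ =>
    hV _ (congrArg (fun T : Op => T ξ) hkhigh)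
  have hVlow : ∀ ξ, V (low q.h ξ) = low q.h ξ := fun ξ => by
    have := hVhigh (low q.h ξ)
    rwa [← mul_apply_eq_comp, high_mul_low] at this
  have hVkq : ∀ ξ, V (kq ξ) = kq ξ := fun ξ => by
    have := hVlow (kq ξ)
    rwa [← mul_apply_eq_comp, hlowkq] at this
  have hVψ : ∀ a ∈ q.F, ∀ ξ, V (q.ψ a ξ) = q.ψ a ξ := fun a ha ξ =>
    hV _ (congrArg (fun T : Op => T ξ) (mul_eq_of_mem_corner hkR hkhigh
      (X.D_subset _ q.R_mem _ q.h_mem (q.ψ_mem a ha))))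
  refine ⟨h, hhC, hhk, c.comp ρ, ?_, ?_, ?_, ?_⟩
  · rw [injective_iff_map_eq_zero]
    intro b hb
    refine (map_eq_zero_iff ρ hρi).1 ?_
    ext1 v
    apply W.injective
    have := congrArg (fun T : Op => T (W v)) hb
    change W (ρ b (W.symm (W v))) = 0 at this
    rw [W.symm_apply_apply] at this
    rw [this]; simp
  · intro b hb
    have e : (ρ b : Hilb → Hilb) = fun v => W.symm ((c.comp ρ) b (W v)) := by
      funext v
      change _ = W.symm (W (ρ b (W.symm (W v))))
      simp
    have h1 : IsCompactOperator (ρ b) := by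
      rw [e]
      exact (hb.comp_clm (W : Hilb →L[ℂ] Hilb)).clm_comp (W.symm : Hilb →L[ℂ] Hilb)
    change c (ρ b) = 0
    rw [hρe b h1, map_zero]
  · intro a ha
    obtain ⟨h1, h2⟩ := hW _ (Finset.mem_image_of_mem _ (Finset.mem_attach G ⟨a, ha⟩))
    constructor
    · rintro _ ⟨ξ, rfl⟩
      exact ⟨_, low_apply_of_fixed (h1 _ (fixed_low k ξ))⟩
    · rintro _ ⟨ξ, rfl⟩
      exact ⟨_, high_apply_of_mem_range (h2 _ (fixed_low h ξ))⟩
  · intro a ha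
    have ha0 : 0 < ‖a‖ := by
      have := (norm_nonneg _).trans_lt (hP.bounded a ha)
      linarith
    refine ⟨?_, ?_, ?_, ?_⟩
    · refine lt_of_le_of_lt ?_ (hP.close a ha)
      refine ContinuousLinearMap.opNorm_le_bound _ (norm_nonneg _) fun ξ => ?_
      refine le_of_eq_of_le ?_ (ContinuousLinearMap.le_opNorm _ ξ)
      rw [← V.norm_map (((q.ψ a - Φ ⟨a, mem_genCStar ha⟩) * (high q.h - kq)) ξ)]
      congr 1
      have e1 : V (high q.h ξ - kq ξ) = high q.h ξ - kq ξ := by rw [map_sub, hVhigh, hVkq]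
      change q.ψ a (high q.h ξ - kq ξ) - (c.comp ρ) _ (high q.h ξ - kq ξ) =
        V (q.ψ a (high q.h ξ - kq ξ) - Φ _ (high q.h ξ - kq ξ))
      rw [map_sub V, hVψ a ha, ← hVΦ a ha, e1]
    · refine (norm_add_mul_one_sub_le V (T₀ := Φ ⟨a, mem_genCStar ha⟩) (hVΦ a ha) ?_
        (isStarProjection_high q.h).isSelfAdjoint.star_eq hVhigh (hVψ a ha)
        (mul_high_of_mem_corner (X.D_subset _ q.R_mem _ q.h_mem (q.ψ_mem a ha)))).trans_lt
        (max_lt (hP.bounded a ha) ?_)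
      · intro ξ
        rw [← map_star, ← map_star]
        exact hVΦ (star a) (q.star_mem a ha) ξ
      · refine lt_of_le_of_lt (NonUnitalStarAlgHom.norm_apply_le (c.comp ρ) _) ?_
        change ‖a‖ < _
        linarith
    · rintro _ ⟨ξ, rfl⟩
      obtain ⟨η, hη⟩ := hP.rep_kp a ha ⟨ξ, rfl⟩
      refine ⟨η, ?_⟩
      rw [← hVkq, hVΦ a ha, ← hη, hVlow]
    · rintro _ ⟨ξ, rfl⟩
      obtain ⟨η, hη⟩ := hP.rep_low a ha ⟨ξ, rfl⟩
      refine ⟨η, ?_⟩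
      rw [← hVlow, hVΦ a ha, ← hη, hVhigh]

/-- The order relation from pointwise estimates: if the new `ψ` is `δ`-close to a representation on
the relevant subspaces, with `3 M δ < ε - ε'`, then it is almost multiplicative, almost linear and
almost self-adjoint there to within `ε - ε'`. -/
theorem Stronger.of_estimates {X : Params} {p q : Condition X A} {kq : Op} {G : Finset A}
    (hG : q.F ⊆ G) (π : genCStar G →⋆ₐ[ℂ] Op) {δ : ℝ}
    (hF : q.F ⊆ p.F) (hε : p.ε < q.ε) (hh : WayAbove p.h q.h) (hR : q.R ≤ p.R)
    (hψ_high : ∀ a ∈ q.F, p.ψ a * high q.h = q.ψ a)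
    (hlow_ψ : ∀ a ∈ q.F, low q.h * p.ψ a = low q.h * q.ψ a)
    (hkq : IsStarProjection kq) (hkq' : low q.h * kq = kq)
    (hδ : 3 * normBound q.F q.ψ * δ < q.ε - p.ε)
    (h₁ : ∀ (a : A) (ha : a ∈ q.F),
      ‖(p.ψ a - π ⟨a, mem_genCStar (hG ha)⟩) * (high p.h - kq)‖ ≤ δ)
    (h₂ : ∀ (a : A) (ha : a ∈ q.F),
      ‖(low p.h - low q.h) * (p.ψ a - π ⟨a, mem_genCStar (hG ha)⟩)‖ ≤ δ)
    (h₃ : ∀ a ∈ q.F, ‖p.ψ a‖ ≤ 3 / 2 * ‖a‖)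
    (h₄ : ∀ (a : A) (ha : a ∈ q.F), MapsRange (π ⟨a, mem_genCStar (hG ha)⟩) kq (low q.h))
    (h₅ : ∀ (a : A) (ha : a ∈ q.F),
      MapsRange (π ⟨a, mem_genCStar (hG ha)⟩) (low p.h) (high p.h)) :
    Stronger p q := by
  have hclG : IsClosed (genCStar G : Set A) := StarSubalgebra.isClosed_topologicalClosure _
  have pe0 := isStarProjection_low q.h
  have pf0 := isStarProjection_low p.h
  have pf := isStarProjection_high p.h
  have f0e0 : low p.h * low q.h = low q.h := low_mul_low hh
  have e0f0 : low q.h * low p.h = low q.h := low_mul_low' hh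
  have ff0 : high p.h * low p.h = low p.h := high_mul_low p.h
  have kqe0 : kq * low q.h = kq := mul_eq_left_of_mul_eq_right hkq pe0 hkq'
  have hE1 : ‖low p.h - low q.h‖ ≤ 1 := norm_sub_le_one pe0 pf0 f0e0
  have hδ0 : 0 ≤ δ := (norm_nonneg _).trans (h₁ 1 q.one_mem)
  have h1A : ‖(1 : A)‖ = 1 := by
    obtain ⟨kp, Φ, hP⟩ := q.promise
    have h0 : Nontrivial A := by
      refine nontrivial_of_ne 1 0 fun h0 => ?_
      have := (norm_nonneg _).trans_lt (hP.bounded 1 q.one_mem)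
      rw [h0, norm_zero] at this
      linarith
    exact CStarRing.norm_one
  set M := normBound q.F q.ψ
  have hM3 : 3 ≤ M := by
    have := three_mul_norm_le_normBound q.ψ q.one_mem
    rwa [h1A, mul_one] at this
  have hML := coeffBound_le_normBound q.F q.ψ
  set E := low p.h - low q.h with hE
  have f0E : low p.h * E = E := by rw [hE, mul_sub, pf0.isIdempotentElem, f0e0]
  have fE : high p.h * E = E := by rw [← f0E, ← mul_assoc, ff0]
  have e0E : low q.h * E = 0 := by rw [hE, mul_sub, e0f0, pe0.isIdempotentElem, sub_self]
  have kqE : kq * E = 0 := by rw [← kqe0, mul_assoc, e0E, mul_zero]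
  have hEs : star E = E := by
    rw [hE, star_sub, pf0.isSelfAdjoint.star_eq, pe0.isSelfAdjoint.star_eq]
  have hfkE : (high p.h - kq) * E = E := by rw [sub_mul, fE, kqE, sub_zero]
  let x : ∀ a ∈ q.F, Op := fun a ha => π ⟨a, mem_genCStar (hG ha)⟩
  have hx₁ : ∀ a (ha : a ∈ q.F), ‖(p.ψ a - x a ha) * E‖ ≤ δ := by
    intro a ha
    rw [← hfkE, ← mul_assoc]
    exact (norm_mul_le_of_norm_le_one hE1).trans (h₁ a ha)
  have hxn : ∀ a (ha : a ∈ q.F), ‖x a ha‖ ≤ ‖a‖ := fun a ha =>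
    NonUnitalStarAlgHom.norm_apply_le π _
  refine ⟨hF, hε, hh, hR, hψ_high, hlow_ψ, ?_, ?_, ?_⟩
  · intro a ha b hb lam mu hab hlam hmu
    have hx : x _ hab = lam • x a ha + mu • x b hb := by
      simp only [x]
      rw [← map_smul, ← map_smul, ← map_add]
      rfl
    have e : deltaAdd p.ψ a b lam mu * E = (p.ψ (lam • a + mu • b) - x _ hab) * E -
        lam • ((p.ψ a - x a ha) * E) - mu • ((p.ψ b - x b hb) * E) := by
      rw [hx, deltaAdd]
      simp only [sub_mul, add_mul, smul_mul_assoc, smul_sub]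
      abel
    rw [e]
    have n1 : ‖lam • ((p.ψ a - x a ha) * E)‖ ≤ M * δ := by
      rw [norm_smul]
      exact mul_le_mul (hlam.trans hML) (hx₁ a ha) (norm_nonneg _) (by linarith)
    have n2 : ‖mu • ((p.ψ b - x b hb) * E)‖ ≤ M * δ := by
      rw [norm_smul]
      exact mul_le_mul (hmu.trans hML) (hx₁ b hb) (norm_nonneg _) (by linarith)
    have n3 := hx₁ _ hab
    have n4 : δ ≤ M * δ := le_mul_of_one_le_left hδ0 (by linarith)
    refine lt_of_le_of_lt ((norm_sub_le _ _).trans (add_le_add ((norm_sub_le _ _).trans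
      (add_le_add n3 n1)) n2)) ?_
    linarith
  · intro a ha
    have hx : x _ (q.star_mem a ha) = star (x a ha) := by
      simp only [x]
      rw [← map_star]
      rfl
    have e : deltaStar p.ψ a * E = (p.ψ (star a) - x _ (q.star_mem a ha)) * E -
        star (E * (p.ψ a - x a ha)) := by
      rw [hx, deltaStar, star_mul, hEs, star_sub]
      noncomm_ring
    rw [e]
    have n1 := hx₁ _ (q.star_mem a ha)
    have n2 : ‖star (E * (p.ψ a - x a ha))‖ ≤ δ :=
      (norm_star (E * (p.ψ a - x a ha))).trans_le (h₂ a ha)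
    have n4 : 3 * δ ≤ M * δ := by gcongr
    refine lt_of_le_of_lt ((norm_sub_le _ _).trans (add_le_add n1 n2)) ?_
    linarith
  · intro a ha b hb hab
    have hx : x _ hab = x a ha * x b hb := by
      simp only [x]
      rw [← map_mul]
      rfl
    -- the range of `x b E` lies in that of `p.h⁺` and is orthogonal to that of `kq`
    have hxE : (high p.h - kq) * (x b hb * E) = x b hb * E := by
      have h5 : high p.h * (x b hb * low p.h) = x b hb * low p.h :=
        (mapsRange_iff pf.isIdempotentElem).1 (h₅ b hb)
      have e1 : high p.h * (x b hb * E) = x b hb * E := by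
        have e3 : x b hb * E = x b hb * low p.h * E := by rw [mul_assoc, f0E]
        rw [e3, ← mul_assoc, h5]
      have h4 := (mapsRange_iff pe0.isIdempotentElem).1 (h₄ (star b) (q.star_mem b hb))
      have hs : π ⟨star b, mem_genCStar (hG (q.star_mem b hb))⟩ = star (x b hb) := by
        simp only [x]
        rw [← map_star]
        rfl
      rw [hs] at h4
      have e2 : kq * (x b hb * E) = 0 := by
        rw [← mul_assoc, ← mul_mul_of_star hkq pe0 h4, mul_assoc, mul_assoc, e0E, mul_zero,
          mul_zero]
      rw [sub_mul, e1, e2, sub_zero]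
    have e : deltaMul p.ψ a b * E = (p.ψ (a * b) - x _ hab) * E -
        p.ψ a * ((p.ψ b - x b hb) * E) -
        ((p.ψ a - x a ha) * (high p.h - kq)) * (x b hb * E) := by
      rw [mul_assoc (p.ψ a - x a ha), hxE, hx, deltaMul]
      noncomm_ring
    rw [e]
    have n0 : ‖p.ψ a‖ ≤ M / 2 := by
      have := three_mul_norm_le_normBound q.ψ ha
      linarith [h₃ a ha]
    have n1 : ‖p.ψ a * ((p.ψ b - x b hb) * E)‖ ≤ M / 2 * δ :=
      (norm_mul_le _ _).trans (mul_le_mul n0 (hx₁ b hb) (norm_nonneg _) (by linarith))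
    have n2 : ‖x b hb * E‖ ≤ M / 3 := by
      have := three_mul_norm_le_normBound q.ψ hb
      linarith [(norm_mul_le_of_norm_le_one (S := x b hb) hE1).trans (hxn b hb)]
    have n3 : ‖((p.ψ a - x a ha) * (high p.h - kq)) * (x b hb * E)‖ ≤ δ * (M / 3) :=
      (norm_mul_le _ _).trans (mul_le_mul (h₁ a ha) n2 (norm_nonneg _) hδ0)
    have n4 : 3 * δ ≤ M * δ := by gcongr
    refine lt_of_le_of_lt ((norm_sub_le _ _).trans (add_le_add ((norm_sub_le _ _).trans
      (add_le_add (hx₁ _ hab) n1)) n3)) ?_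
    nlinarith

end Conditions

/-! ### Density -/

section Density

open Filter Topology

variable {A : Type*} [CStarAlgebra A]

theorem eventually_add_mul_lt {c d : ℝ} (t : ℝ) (h : c < d) :
    ∀ᶠ η in 𝓝[>] (0 : ℝ), c + t * η < d := by
  have h1 : Tendsto (fun η : ℝ => c + t * η) (𝓝[>] 0) (𝓝 (c + t * 0)) :=
    (Continuous.tendsto (by fun_prop) 0).mono_left nhdsWithin_le_nhds
  rw [mul_zero, add_zero] at h1
  exact h1.eventually_lt_const h

/-- Below every condition there is a stronger one in the given set. -/
theorem exists_stronger (hA : IsSimpleCStar A) (X : Params) (q : Condition X A) (F : Finset A)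
    (hF : (0 : A) ∉ F) (ε : ℚ) (hε : 0 < ε) (h : Op) (hh : h ∈ X.C) (R : Op)
    (hR : R ∈ Set.range X.proj) :
    ∃ p : Condition X A, Stronger p q ∧ p ∈ denseSet X F ε h R := by
  classical
  have := hA.1
  have h1A : ‖(1 : A)‖ = 1 := CStarRing.norm_one
  obtain ⟨kq, Φ, hP⟩ := q.promise
  set G : Finset A := q.F ∪ (F ∪ F.image star) with hGdef
  have hG : q.F ⊆ G := Finset.subset_union_left
  have hFG : F ⊆ G := Finset.subset_union_left.trans Finset.subset_union_right
  have h1G : (1 : A) ∈ G := hG q.one_mem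
  have hGs : ∀ a ∈ G, star a ∈ G := by
    intro a ha
    simp only [hGdef, Finset.mem_union, Finset.mem_image] at ha ⊢
    rcases ha with ha | ha | ⟨b, hb, rfl⟩
    · exact Or.inl (q.star_mem a ha)
    · exact Or.inr (Or.inr ⟨a, ha, rfl⟩)
    · exact Or.inr (Or.inl (by rwa [star_star]))
  have hG0 : ∀ a ∈ G, 0 < ‖a‖ := by
    intro a ha
    simp only [hGdef, Finset.mem_union, Finset.mem_image] at ha
    rcases ha with ha | ha | ⟨b, hb, rfl⟩
    · have := (norm_nonneg _).trans_lt (hP.bounded a ha)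
      linarith
    · exact norm_pos_iff.2 fun h0 => hF (h0 ▸ ha)
    · rw [norm_star]
      exact norm_pos_iff.2 fun h0 => hF (h0 ▸ hb)
  have hclG : IsClosed (genCStar G : Set A) := StarSubalgebra.isClosed_topologicalClosure _
  obtain ⟨m₁, hm₁⟩ := q.R_mem
  obtain ⟨m₂, rfl⟩ := hR
  -- `k⁻` will be the projection `k_p` of the new promise
  obtain ⟨k, hkC, hks, hkR⟩ := exists_mem_C_wayAbove X {q.h, h} (by simp)
    (by simpa [Set.insert_subset_iff] using ⟨q.h_mem, hh⟩) (R := X.proj (max m₁ m₂)) ⟨_, rfl⟩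
  have hkq : WayAbove k q.h := hks _ (by simp)
  have hkh : WayAbove k h := hks _ (by simp)
  have hkqR : k * q.R = q.R := by
    rw [← hm₁]
    exact mul_eq_of_posContr_of_le (X.C_subset hkC) (X.proj_isStarProjection m₁)
      ((X.proj_mono (le_max_left m₁ m₂)).trans hkR)
  have hlowR : low k * q.R = q.R := by
    ext1 ξ
    exact low_apply_of_fixed (congrArg (fun T : Op => T ξ) hkqR)
  have hlowkq : low q.h * kq = kq :=
    (hP.isStarProjection.le_iff_mul_eq_right (isStarProjection_low _)).1 hP.le_low
  obtain ⟨h', hh'C, hh'k, π, hπi, hπe, hπG, hπq⟩ := exists_adapted_rep hA q hP hG hkC hkq hkqR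
  have hh'q : WayAbove h' q.h := mul_eq_of_mul_eq_of_mul_eq hkq hh'k
  have hh'h : WayAbove h' h := mul_eq_of_mul_eq_of_mul_eq hkh hh'k
  let x : G → Op := fun a => π ⟨a, mem_genCStar a.2⟩
  have hxn : ∀ a : G, ‖x a‖ ≤ ‖(a : A)‖ := fun a => NonUnitalStarAlgHom.norm_apply_le π _
  have hxs : ∀ a : G, star (x a) = x ⟨star a, hGs a a.2⟩ := fun a => by
    simp only [x]
    rw [← map_star]
    rfl
  let y : {a // a ∈ q.F} → G := fun a => ⟨a, hG a.2⟩
  -- the error budget: `δ` is inherited from the promise of `q`, and the strict inequality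
  -- `3 M δ < ε_q` leaves room for `ε'` and for the approximation error `η`
  obtain ⟨a₀, -, ha₀⟩ := Finset.exists_max_image q.F.attach
    (fun a => ‖(q.ψ a - x (y a)) * (high q.h - kq)‖) ⟨⟨1, q.one_mem⟩, Finset.mem_attach _ _⟩
  set δ : ℝ := ‖(q.ψ a₀ - x (y a₀)) * (high q.h - kq)‖
  have hδq : ∀ a : {a // a ∈ q.F}, ‖(q.ψ a - x (y a)) * (high q.h - kq)‖ ≤ δ :=
    fun a => ha₀ a (Finset.mem_attach _ _)
  set M := normBound q.F q.ψ
  have hM3 : 3 ≤ M := by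
    have := three_mul_norm_le_normBound q.ψ q.one_mem
    rwa [h1A, mul_one] at this
  have hMδ : 3 * M * δ < q.ε := by
    have h0 := (hπq a₀ a₀.2).1
    change δ < _ at h0
    rw [lt_div_iff₀ (by linarith)] at h0
    linarith
  obtain ⟨ε', hε'0, hε'⟩ := exists_rat_btwn
    (lt_min (Rat.cast_pos.2 hε) (sub_pos.2 hMδ) : (0 : ℝ) < min (ε : ℝ) (q.ε - 3 * M * δ))
  have hε'pos : 0 < ε' := by exact_mod_cast hε'0
  have hε'ε : ε' ≤ ε := by exact_mod_cast (hε'.trans_le (min_le_left _ _)).le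
  have hε'q : 3 * M * δ < q.ε - ε' := by linarith [hε'.trans_le (min_le_right _ _)]
  obtain ⟨B, hB⟩ := (G.finite_toSet.image (fun a => ‖a‖)).bddAbove
  have hB' : ∀ a ∈ G, ‖a‖ ≤ B := fun a ha => hB ⟨a, ha, rfl⟩
  -- an upper bound for the constant `M_p` of the new condition, known before `ψ` is chosen
  set M' := max (9 / 2 * B) (coeffBound G)
  have hM'0 : 0 < M' := by
    have := hB' 1 h1G
    rw [h1A] at this
    exact lt_of_lt_of_le (by linarith) (le_max_left _ _)
  obtain ⟨η, hη1, hη2, hη3, hη4, hη0⟩ : ∃ η : ℝ,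
      (∀ a ∈ q.F.attach, ‖q.ψ a + x (y a) * (1 - high q.h)‖ + 2 * η < 3 / 2 * ‖(a : A)‖) ∧
      (∀ a ∈ G.attach, ‖(a : A)‖ + 2 * η < 3 / 2 * ‖(a : A)‖) ∧
      0 + 2 * η < (ε' : ℝ) / (3 * M') ∧ 3 * M * δ + (3 * M * 2) * η < q.ε - ε' ∧ 0 < η := by
    refine Eventually.exists (f := 𝓝[>] (0 : ℝ)) ?_
    refine ((Filter.eventually_all_finset _).2 fun (a : {a // a ∈ q.F}) _ =>
      eventually_add_mul_lt 2 (hπq a a.2).2.1).and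
      (((Filter.eventually_all_finset _).2 fun (a : {a // a ∈ G}) _ =>
        eventually_add_mul_lt 2 (by linarith [hG0 a a.2])).and
        ((eventually_add_mul_lt 2 (div_pos hε'0 (by linarith))).and
          ((eventually_add_mul_lt _ hε'q).and self_mem_nhdsWithin)))
  -- `R_p` is chosen so large that compressing by `S` costs at most `η`
  have hh'fd : FiniteDimensional ℂ (LinearMap.range h'.toLinearMap) := (X.C_subset hh'C).1
  obtain ⟨n, hn, hnm⟩ : ∃ n, (∀ a ∈ G.attach, ‖(1 - X.proj n) * (x a * high h')‖ ≤ η) ∧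
      max m₁ m₂ ≤ n := by
    refine Eventually.exists (f := (atTop : Filter ℕ)) ?_
    refine ((Filter.eventually_all_finset _).2 fun (a : {a // a ∈ G}) _ =>
      eventually_norm_one_sub_mul_le X.proj_tendsto ?_ hη0).and (eventually_ge_atTop _)
    exact finiteRank_of_range_le (M := (LinearMap.range h'.toLinearMap).map (x a).toLinearMap)
      fun ξ => ⟨high h' ξ, mem_range_of_high_apply (X.C_subset hh'C).1
        (congrArg (fun T : Op => T ξ) (isStarProjection_high h').isIdempotentElem), rfl⟩
  have hRp : X.proj n ∈ Set.range X.proj := ⟨n, rfl⟩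
  have hff : high h' * high h' = high h' := (isStarProjection_high h').isIdempotentElem
  have hkk : low h' * low k = low k := low_mul_low hh'k
  -- the value of the new map at each element of `G`
  have key : ∀ a : G, ∃ ψ ∈ X.D (X.proj n) h', ((a : A) = 1 → ψ = high h') ∧
      MapsRange ψ (low k) (low h') ∧ MapsRange ψ (low h') (high h') ∧
      ‖(ψ - x a) * (high h' - low k)‖ ≤ 2 * η ∧
      ‖ψ + x a * (1 - high h')‖ < 3 / 2 * ‖(a : A)‖ ∧
      ((a : A) ∈ q.F → ψ * high q.h = q.ψ a ∧ low q.h * ψ = low q.h * q.ψ a ∧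
        ‖(ψ - x a) * (high h' - kq)‖ ≤ δ + 2 * η ∧
        ‖(low h' - low q.h) * (ψ - x a)‖ ≤ δ + 2 * η) := by
    rintro ⟨a, ha⟩
    obtain ⟨hx₁, hx₂⟩ := hπG a ha
    by_cases ha1 : a = 1
    · subst ha1
      have hx1 : x ⟨1, ha⟩ = 1 := map_one π
      have hfh : high h' * high q.h = high q.h := high_mul_high hh'q
      have hfl : high h' * low q.h = low q.h :=
        mul_eq_of_mul_eq_of_mul_eq (high_mul_low q.h) hfh
      have hfk : high h' * low k = low k := mul_eq_of_mul_eq_of_mul_eq hkk (high_mul_low h')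
      have hlf : low q.h * high h' = low q.h := mul_eq_left_of_mul_eq_right
        (isStarProjection_low _) (isStarProjection_high _) hfl
      have hlf' : low h' * high h' = low h' := mul_eq_left_of_mul_eq_right
        (isStarProjection_low _) (isStarProjection_high _) (high_mul_low h')
      have hfkq : high h' * kq = kq := mul_eq_of_mul_eq_of_mul_eq hlowkq hfl
      have hδ0 : 0 ≤ δ := norm_nonneg _
      refine ⟨high h', X.high_mem_D _ hRp _ hh'C, fun _ => rfl, ?_, ?_, ?_, ?_, fun _ =>
        ⟨?_, ?_, ?_, ?_⟩⟩
      · rw [mapsRange_iff (low_idem h'), hfk, hkk]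
      · rw [mapsRange_iff hff, high_mul_low, high_mul_low]
      · have e : (high h' - x ⟨1, ha⟩) * (high h' - low k) = 0 := by
          rw [hx1, sub_mul, mul_sub, hff, hfk, one_mul, sub_self]
        rw [e, norm_zero]
        linarith
      · have e : high h' + x ⟨1, ha⟩ * (1 - high h') = 1 := by rw [hx1]; noncomm_ring
        rw [e, h1A]
        linarith [(IsStarProjection.one (R := Op)).norm_le]
      · rw [hfh, hP.map_one]
      · rw [hlf, hP.map_one]
        exact (mul_eq_left_of_mul_eq_right (isStarProjection_low _) (isStarProjection_high _)
          (high_mul_low q.h)).symm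
      · have e : (high h' - x ⟨1, ha⟩) * (high h' - kq) = 0 := by
          rw [hx1, sub_mul, mul_sub, hff, hfkq, one_mul, sub_self]
        rw [e, norm_zero]
        linarith
      · have e : (low h' - low q.h) * (high h' - x ⟨1, ha⟩) = 0 := by
          rw [hx1, mul_sub, sub_mul, hlf, hlf', mul_one, sub_self]
        rw [e, norm_zero]
        linarith
    have hna := hn ⟨a, ha⟩ (Finset.mem_attach _ _)
    by_cases haq : a ∈ q.F
    · obtain ⟨-, -, hx₄, -⟩ := hπq a haq
      obtain ⟨ψ, hψD, p1, p2, p3, p4, p5, p6, p7, p8⟩ := exists_mem_D_of_old hRp hh'C hkC q.R_mem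
        q.h_mem (q.ψ_mem a haq) hh'k hkq hlowR hP.isStarProjection hlowkq (x := x ⟨a, ha⟩) hx₁ hx₂
        (by rw [hxs]; exact (hπG _ (hGs a ha)).2) hx₄
        (by rw [hxs]; exact (hπq _ (q.star_mem a haq)).2.2.2) (hP.map_kp a haq) hη0 hna
      have hδa : ‖(q.ψ a - x ⟨a, ha⟩) * (high q.h - kq)‖ ≤ δ := hδq ⟨a, haq⟩
      refine ⟨ψ, hψD, fun h1 => absurd h1 ha1, p3, p4, p5,
        p6.trans_lt (hη1 ⟨a, haq⟩ (Finset.mem_attach _ _)), fun _ => ⟨p1, p2, ?_, ?_⟩⟩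
      · exact p7.trans (by linarith)
      · exact p8.trans (by linarith)
    · obtain ⟨ψ, hψD, p1, p2, p3, p4⟩ := exists_mem_D_of_new hRp hh'C hkC hh'k (x := x ⟨a, ha⟩)
        hx₁ hx₂ hη0 hna
      refine ⟨ψ, hψD, fun h1 => absurd h1 ha1, p1, p2, p3, ?_, fun h1 => absurd h1 haq⟩
      have h2 := hη2 ⟨a, ha⟩ (Finset.mem_attach _ _)
      exact p4.trans_lt (lt_of_le_of_lt (by linarith [hxn ⟨a, ha⟩]) h2)
  choose ψ₀ hψD hψ1 hψk hψlow hψκ hψbd hψq using key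
  set ψ : A → Op := fun a => if ha : a ∈ G then ψ₀ ⟨a, ha⟩ else 0
  have hψ : ∀ a (ha : a ∈ G), ψ a = ψ₀ ⟨a, ha⟩ := fun a ha => dif_pos ha
  have hψn : ∀ a ∈ G, ‖ψ a‖ ≤ 3 / 2 * ‖a‖ := by
    intro a ha
    have hc : ψ₀ ⟨a, ha⟩ * high h' = ψ₀ ⟨a, ha⟩ :=
      mul_high_of_mem_corner (X.D_subset _ hRp _ hh'C (hψD ⟨a, ha⟩))
    have e : ψ a = (ψ₀ ⟨a, ha⟩ + x ⟨a, ha⟩ * (1 - high h')) * high h' := by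
      rw [add_mul, mul_assoc, sub_mul, one_mul, hff, sub_self, mul_zero, add_zero, hc, hψ a ha]
    rw [e]
    exact (norm_mul_le_of_norm_le_one (isStarProjection_high h').norm_le).trans
      (hψbd ⟨a, ha⟩).le
  have hnb : normBound G ψ ≤ M' := by
    refine normBound_le (fun a ha => ?_) (fun a ha => ?_) (le_max_right _ _)
    · exact le_trans (by linarith [hB' a ha, norm_nonneg a]) (le_max_left _ _)
    · exact le_trans (by linarith [hB' a ha, hψn a ha]) (le_max_left _ _)
  have hnb0 : 0 < normBound G ψ := by
    have := three_mul_norm_le_normBound ψ h1G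
    rw [h1A] at this
    linarith
  let p : Condition X A :=
    { F := G
      ε := ε'
      h := h'
      R := X.proj n
      ψ := ψ
      one_mem := h1G
      star_mem := hGs
      ε_pos := hε'pos
      h_mem := hh'C
      R_mem := hRp
      ψ_mem := fun a ha => by rw [hψ a ha]; exact hψD _
      ψ_off := fun a ha => dif_neg ha
      promise := ⟨low k, π,
        { faithful := hπi
          essential := hπe
          isStarProjection := isStarProjection_low k
          le_low := (isStarProjection_low k).le_of_mul_eq_right (isStarProjection_low h') hkk
          eq_low := ⟨k, hkC, rfl⟩
          map_one := by rw [hψ 1 h1G]; exact hψ1 _ rfl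
          close := fun a ha => by
            rw [hψ a ha]
            have h2 : 2 * η < (ε' : ℝ) / (3 * M') := by linarith
            have h3 : (ε' : ℝ) / (3 * M') ≤ ε' / (3 * normBound G ψ) := by gcongr
            exact (hψκ ⟨a, ha⟩).trans_lt (h2.trans_le h3)
          bounded := fun a ha => by rw [hψ a ha]; exact hψbd ⟨a, ha⟩
          map_kp := fun a ha => by rw [hψ a ha]; exact hψk ⟨a, ha⟩
          map_low := fun a ha => by rw [hψ a ha]; exact hψlow ⟨a, ha⟩
          rep_kp := fun a ha => (hπG a ha).1
          rep_low := fun a ha => (hπG a ha).2 }⟩ }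
  have hpψ : ∀ a (ha : a ∈ q.F), p.ψ a = ψ₀ (y ⟨a, ha⟩) := fun a ha => hψ a (hG ha)
  refine ⟨p, ?_, hFG, hε'ε, hh'h, X.proj_mono ((le_max_right _ _).trans hnm)⟩
  refine Stronger.of_estimates hG π (δ := δ + 2 * η) (kq := kq) hG ?_ hh'q ?_ ?_ ?_
    hP.isStarProjection hlowkq ?_ ?_ ?_ ?_ ?_ ?_
  · have h0 : (0 : ℝ) ≤ 3 * M * δ := mul_nonneg (by linarith) (norm_nonneg _)
    have h1 : (ε' : ℝ) < q.ε := by linarith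
    exact_mod_cast h1
  · rw [← hm₁]
    exact X.proj_mono ((le_max_left _ _).trans hnm)
  · intro a ha
    rw [hpψ a ha]
    exact (hψq (y ⟨a, ha⟩) ha).1
  · intro a ha
    rw [hpψ a ha]
    exact (hψq (y ⟨a, ha⟩) ha).2.1
  · change 3 * M * (δ + 2 * η) < (q.ε : ℝ) - ε'
    linarith
  · intro a ha
    rw [hpψ a ha]
    exact (hψq (y ⟨a, ha⟩) ha).2.2.1
  · intro a ha
    rw [hpψ a ha]
    exact (hψq (y ⟨a, ha⟩) ha).2.2.2
  · exact fun a ha => hψn a (hG ha)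
  · exact fun a ha => (hπq a ha).2.2.1
  · exact fun a ha => (hπG a (hG ha)).2

theorem denseSet_lower {X : Params} {F : Finset A} {ε : ℚ} {h R : Op} {p q : Condition X A}
    (hp : p ∈ denseSet X F ε h R) (hqp : q ≤ p) : q ∈ denseSet X F ε h R := by
  rcases hqp with hqp | rfl
  · exact ⟨hp.1.trans hqp.F_sub, hqp.ε_lt.le.trans hp.2.1,
      mul_eq_of_mul_eq_of_mul_eq hp.2.2.1 hqp.h_way, hp.2.2.2.trans hqp.R_le⟩
  · exact hp

end Density
end CalkinForcing

theorem mainTheorem5 {A : Type*} [CStarAlgebra A] (hA : CalkinForcing.IsSimpleCStar A)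
    (X : CalkinForcing.Params) (F : Finset A) (hF : (0 : A) ∉ F) (ε : ℚ) (hε : 0 < ε)
    (h : CalkinForcing.Op) (hh : h ∈ X.C) (R : CalkinForcing.Op) (hR : R ∈ Set.range X.proj) :
    CalkinForcing.IsOpenDense (CalkinForcing.denseSet (A := A) X F ε h R) := by
  refine ⟨fun p hp q hqp => CalkinForcing.denseSet_lower hp hqp, fun q => ?_⟩
  obtain ⟨p, hpq, hp⟩ := CalkinForcing.exists_stronger hA X q F hF ε hε h hh R hR
  exact ⟨p, hp, Or.inl hpq⟩
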